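/- Let $G$ be a finite connected simple graph with $d$ vertices and $e$ edges that contains at least one odd cycle. Let $c_4(G)$ be the number of $4$-cycles of $G$ and $k_4(G)$ the number of subgraphs of $G$ isomorphic to the complete graph $K_4$. If $k_4(G)\le 1$, then $$c_4(G)\le\binom{e-d+1}{2}.$$ If moreover $G$ has no vertex of degree one and $k_4(G)=0$, then equality holds if and only if $G$ is one of the following: (a) an odd cycle; (b) a graph obtained by adding a path to a complete bipartite graph $K_{2,m}$ with $m\ge 1$, that is, the union of $K_{2,m}$ and a path joining two distinct vertices of $K_{2,m}$ that has no other vertex and no edge in common with $K_{2,m}$; (c) a graph whose blocks (maximal connected subgraphs without a cut vertex) are exactly one $K_{2,m}$, exactly one odd cycle and, possibly, bridges. -/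

import Mathlib

namespace FourCycles

variable {V : Type*}

/-- The number of `4`-cycles of `G`: the number of subgraphs of `G` isomorphic to the cycle of
length `4`. -/
noncomputable def c4 [Fintype V] (G : SimpleGraph V) : ℕ :=
  G.copyCount (SimpleGraph.cycleGraph 4)

/-- The number of subgraphs of `G` isomorphic to the complete graph with `4` vertices. -/
noncomputable def k4 [Fintype V] (G : SimpleGraph V) : ℕ :=
  G.copyCount (SimpleGraph.completeGraph (Fin 4))

/-- `G` contains a cycle of odd length. -/
def HasOddCycle (G : SimpleGraph V) : Prop :=
  ∃ (v : V) (p : G.Walk v v), p.IsCycle ∧ Odd p.length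

/-- `G` is (isomorphic to) a cycle of odd length. -/
def IsOddCycle (G : SimpleGraph V) : Prop :=
  ∃ n : ℕ, 3 ≤ n ∧ Odd n ∧ Nonempty (G ≃g SimpleGraph.cycleGraph n)

/-- `G` is (isomorphic to) a complete bipartite graph `K_{2,m}` with `m ≥ 1`. -/
def IsK2m (G : SimpleGraph V) : Prop :=
  ∃ m : ℕ, 1 ≤ m ∧ Nonempty (G ≃g completeBipartiteGraph (Fin 2) (Fin m))

/-- `G` is obtained by adding a path to a complete bipartite graph `K_{2,m}`: `G` is the union of a
subgraph `K` isomorphic to `K_{2,m}` and a path `p` joining two distinct vertices of `K`,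
such that `p` has no other vertex and no edge in common with `K`. -/
def IsK2mWithPath (G : SimpleGraph V) : Prop :=
  ∃ (K : G.Subgraph) (u v : V) (p : G.Walk u v),
    IsK2m K.coe ∧ p.IsPath ∧ u ≠ v ∧
    (∀ x : V, (x ∈ K.verts ∧ x ∈ p.support) ↔ (x = u ∨ x = v)) ∧
    (∀ s ∈ p.edges, s ∉ K.edgeSet) ∧
    K ⊔ p.toSubgraph = ⊤

/-- A block (`2`-connected component) of `G`: a maximal connected subgraph without a cut vertex.
The blocks of a connected graph with an edge are its maximal `2`-connected subgraphs
and its bridges (with their end vertices). -/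
def IsBlock (G : SimpleGraph V) (B : G.Subgraph) : Prop :=
  Maximal (fun H : G.Subgraph =>
    H.Connected ∧ ∀ x ∈ H.verts, (H.deleteVerts {x}).Preconnected) B

/-- The subgraph `B` of `G` consists of a bridge of `G` and its two end vertices. -/
def IsBridgeSubgraph (G : SimpleGraph V) (B : G.Subgraph) : Prop :=
  ∃ (u v : V) (h : G.Adj u v), G.IsBridge s(u, v) ∧ B = G.subgraphOfAdj h

/-- The blocks of `G` are one `K_{2,m}`, one odd cycle, and (any number of, possibly no)
bridges. -/
def BlocksK2mOddCycleBridges (G : SimpleGraph V) : Prop :=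
  ∃ B₁ B₂ : G.Subgraph, IsBlock G B₁ ∧ IsBlock G B₂ ∧ IsK2m B₁.coe ∧ IsOddCycle B₂.coe ∧
    ∀ B : G.Subgraph, IsBlock G B → B ≠ B₁ → B ≠ B₂ → IsBridgeSubgraph G B

end FourCycles

/-!
Write `g = e - d + 1` for the cyclomatic number.

*The inequality.* In a connected non-bipartite graph with at most one `K₄`, every edge `ab` lies on
at most `g - 1` four-cycles (`card_cyclesThrough_add_one_le`): the edges opposite to `ab` in these
`4`-cycles can be deleted without disconnecting the graph, and if there were `g` of them, the
remaining tree would have a `2`-colouring that is proper for the deleted edges as well. Deleting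
an edge of a `4`-cycle keeps the graph connected and non-bipartite and lowers `g` by one, so
`(g - 1) + (g - 1).choose 2 = g.choose 2` gives the bound by induction (`card_fourCycles_le`).

*Equality implies a `K_{2,g}`.* If equality holds, `g ≥ 2` and there is no `K₄`, every edge on a
`4`-cycle lies on exactly `g - 1` of them, hence exactly `2 * g` edges lie on `4`-cycles, and
deleting one such edge `e` preserves equality. For `g ≥ 3`, comparing `2 * g` with `2 * (g - 1)`
gives an edge `f ≠ e` on the same `4`-cycles as `e`. These `g - 1` four-cycles through `e` and `f`
yield two vertices with `g` common neighbours (`IsExtremal.exists_common_neighbors`).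

*The structure.* The subgraph `K = K_{2,g}` has cyclomatic number `g - 1`. If `K` is not a block, it
has an ear, and counting vertices and edges shows that nothing else is left in a graph without
leaves. If `K` is a block, the inequality itself shows that every edge outside of `K` and of a fixed
odd cycle is a bridge, since deleting it would leave too many `4`-cycles
(`isBridge_of_notMem`); hence the remaining blocks are that odd cycle and bridges.

*The converse.* A graph containing a `K_{2,m}` has at least `m.choose 2` four-cycles, so it
suffices that `g ≤ m`, which is a count of vertices and edges for `K_{2,m}` with a path. For the
graphs given by their blocks, every cycle lies in a block, so it is met by the edges outside of
spanning trees of the two blocks that are not bridges; there are `m` such edges.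
-/

namespace FourCycles

open Finset

variable {V : Type*}

/-! ### Four-cycles as sets of edges -/

/-- The closed walk `a b c d a` is a `4`-cycle of `G`. -/
def IsFourCycle (G : SimpleGraph V) (a b c d : V) : Prop :=
  G.Adj a b ∧ G.Adj b c ∧ G.Adj c d ∧ G.Adj d a ∧ a ≠ c ∧ b ≠ d

/-- The edge set of the closed walk `a b c d a`. -/
def cycleEdges [DecidableEq V] (a b c d : V) : Finset (Sym2 V) :=
  {s(a, b), s(b, c), s(c, d), s(d, a)}

lemma IsFourCycle.rotate {G : SimpleGraph V} {a b c d : V} (h : IsFourCycle G a b c d) :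
    IsFourCycle G b c d a :=
  ⟨h.2.1, h.2.2.1, h.2.2.2.1, h.1, h.2.2.2.2.2, h.2.2.2.2.1.symm⟩

lemma IsFourCycle.reflect {G : SimpleGraph V} {a b c d : V} (h : IsFourCycle G a b c d) :
    IsFourCycle G b a d c :=
  ⟨h.1.symm, h.2.2.2.1.symm, h.2.2.1.symm, h.2.1.symm, h.2.2.2.2.2, h.2.2.2.2.1⟩

lemma IsFourCycle.mono {G H : SimpleGraph V} (hGH : G ≤ H) {a b c d : V}
    (h : IsFourCycle G a b c d) : IsFourCycle H a b c d :=
  ⟨hGH h.1, hGH h.2.1, hGH h.2.2.1, hGH h.2.2.2.1, h.2.2.2.2⟩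

lemma cycleEdges_rotate [DecidableEq V] (a b c d : V) :
    cycleEdges b c d a = cycleEdges a b c d := by
  ext e; simp only [cycleEdges, mem_insert, mem_singleton]; tauto

lemma cycleEdges_reflect [DecidableEq V] (a b c d : V) :
    cycleEdges b a d c = cycleEdges a b c d := by
  ext e
  simp only [cycleEdges, mem_insert, mem_singleton, Sym2.eq_swap (a := b) (b := a),
    Sym2.eq_swap (a := a) (b := d), Sym2.eq_swap (a := d) (b := c), Sym2.eq_swap (a := c) (b := b)]
  tauto

lemma IsFourCycle.card_cycleEdges [DecidableEq V] {G : SimpleGraph V} {a b c d : V}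
    (h : IsFourCycle G a b c d) : (cycleEdges a b c d).card = 4 := by
  obtain ⟨h1, h2, h3, h4, h5, h6⟩ := h
  have := h1.ne; have := h2.ne; have := h3.ne; have := h4.ne
  unfold cycleEdges
  rw [card_insert_of_notMem, card_insert_of_notMem, card_insert_of_notMem, card_singleton] <;>
    simp only [mem_insert, mem_singleton, Sym2.eq_iff] <;> grind

/-- The set of `4`-cycles of `G`, each given by its set of edges. -/
noncomputable def fourCycles [Fintype V] [DecidableEq V] (G : SimpleGraph V) :
    Finset (Finset (Sym2 V)) := by
  classical exact univ.filter fun F => ∃ a b c d, IsFourCycle G a b c d ∧ F = cycleEdges a b c d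

lemma mem_fourCycles [Fintype V] [DecidableEq V] {G : SimpleGraph V} {F : Finset (Sym2 V)} :
    F ∈ fourCycles G ↔ ∃ a b c d, IsFourCycle G a b c d ∧ F = cycleEdges a b c d := by
  simp [fourCycles]

lemma IsFourCycle.mem_edgeSet [DecidableEq V] {G : SimpleGraph V} {a b c d : V}
    (h : IsFourCycle G a b c d) {e : Sym2 V} (he : e ∈ cycleEdges a b c d) : e ∈ G.edgeSet := by
  obtain ⟨h1, h2, h3, h4, -⟩ := h
  simp only [cycleEdges, mem_insert, mem_singleton] at he
  rcases he with rfl | rfl | rfl | rfl <;> assumption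

lemma edgeSet_copy_cycleGraph [DecidableEq V] {G : SimpleGraph V}
    (f : SimpleGraph.Copy (SimpleGraph.cycleGraph 4) G) :
    f.toSubgraph.edgeSet = (cycleEdges (f 0) (f 1) (f 2) (f 3) : Set (Sym2 V)) := by
  ext e
  induction e with | h x y =>
  have key : ∀ i j : Fin 4, (SimpleGraph.cycleGraph 4).Adj i j ↔
      (i = 0 ∧ j = 1 ∨ i = 1 ∧ j = 0 ∨ i = 1 ∧ j = 2 ∨ i = 2 ∧ j = 1 ∨ i = 2 ∧ j = 3 ∨
        i = 3 ∧ j = 2 ∨ i = 3 ∧ j = 0 ∨ i = 0 ∧ j = 3) := by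
    simp only [SimpleGraph.cycleGraph_adj]; decide
  simp only [SimpleGraph.Subgraph.mem_edgeSet, SimpleGraph.Subgraph.map_adj, Relation.Map,
    SimpleGraph.Subgraph.top_adj, key, cycleEdges, coe_insert, coe_singleton,
    Set.mem_insert_iff, Set.mem_singleton_iff, Sym2.eq_iff, SimpleGraph.Copy.toHom_apply]
  constructor
  · rintro ⟨i, j, h, rfl, rfl⟩
    rcases h with ⟨rfl, rfl⟩ | ⟨rfl, rfl⟩ | ⟨rfl, rfl⟩ | ⟨rfl, rfl⟩ | ⟨rfl, rfl⟩ | ⟨rfl, rfl⟩ |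
      ⟨rfl, rfl⟩ | ⟨rfl, rfl⟩ <;> simp
  · rintro ((⟨rfl, rfl⟩ | ⟨rfl, rfl⟩) | (⟨rfl, rfl⟩ | ⟨rfl, rfl⟩) | (⟨rfl, rfl⟩ | ⟨rfl, rfl⟩) |
      (⟨rfl, rfl⟩ | ⟨rfl, rfl⟩))
    · exact ⟨0, 1, by simp, rfl, rfl⟩
    · exact ⟨1, 0, by simp, rfl, rfl⟩
    · exact ⟨1, 2, by simp, rfl, rfl⟩
    · exact ⟨2, 1, by simp, rfl, rfl⟩
    · exact ⟨2, 3, by simp, rfl, rfl⟩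
    · exact ⟨3, 2, by simp, rfl, rfl⟩
    · exact ⟨3, 0, by simp, rfl, rfl⟩
    · exact ⟨0, 3, by simp, rfl, rfl⟩

lemma isFourCycle_copy {G : SimpleGraph V}
    (f : SimpleGraph.Copy (SimpleGraph.cycleGraph 4) G) :
    IsFourCycle G (f 0) (f 1) (f 2) (f 3) := by
  have h : ∀ i j : Fin 4, (SimpleGraph.cycleGraph 4).Adj i j → G.Adj (f i) (f j) :=
    fun i j hij => f.toHom.map_adj hij
  refine ⟨h 0 1 ?_, h 1 2 ?_, h 2 3 ?_, h 3 0 ?_, fun h => ?_, fun h => ?_⟩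
  · simp only [SimpleGraph.cycleGraph_adj]; decide
  · simp only [SimpleGraph.cycleGraph_adj]; decide
  · simp only [SimpleGraph.cycleGraph_adj]; decide
  · simp only [SimpleGraph.cycleGraph_adj]; decide
  · exact absurd (f.injective h) (by decide)
  · exact absurd (f.injective h) (by decide)

lemma IsFourCycle.exists_copy {G : SimpleGraph V} {a b c d : V} (h : IsFourCycle G a b c d) :
    ∃ f : SimpleGraph.Copy (SimpleGraph.cycleGraph 4) G,
      f 0 = a ∧ f 1 = b ∧ f 2 = c ∧ f 3 = d := by
  obtain ⟨h1, h2, h3, h4, h5, h6⟩ := h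
  refine ⟨⟨⟨![a, b, c, d], ?_⟩, ?_⟩, rfl, rfl, rfl, rfl⟩
  · intro i j hij
    fin_cases i <;> fin_cases j <;>
      first
      | (exfalso; revert hij; simp only [SimpleGraph.cycleGraph_adj]; decide)
      | assumption
      | (apply SimpleGraph.Adj.symm; assumption)
  · have := h1.ne; have := h2.ne; have := h3.ne; have := h4.ne
    intro i j hij
    fin_cases i <;> fin_cases j <;> simp_all

/-- The number of `4`-cycles counted as subgraphs agrees with the number of their edge sets. -/
lemma c4_eq_card_fourCycles [Fintype V] [DecidableEq V] (G : SimpleGraph V) :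
    c4 G = (fourCycles G).card := by
  classical
  unfold c4
  rw [SimpleGraph.copyCount_eq_card_image_copyToSubgraph]
  have hedge (f : SimpleGraph.Copy (SimpleGraph.cycleGraph 4) G) :
      f.toSubgraph.edgeSet.toFinset = cycleEdges (f 0) (f 1) (f 2) (f 3) := by
    ext e; rw [Set.mem_toFinset, edgeSet_copy_cycleGraph, mem_coe]
  have hverts (f : SimpleGraph.Copy (SimpleGraph.cycleGraph 4) G) (v : V) :
      v ∈ f.toSubgraph.verts ↔ ∃ e ∈ f.toSubgraph.edgeSet, v ∈ e := by
    constructor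
    · intro hv
      obtain ⟨i, -, rfl⟩ := hv
      rw [edgeSet_copy_cycleGraph]
      simp only [cycleEdges, coe_insert, coe_singleton, Set.mem_insert_iff, Set.mem_singleton_iff,
        exists_eq_or_imp, exists_eq_left, Sym2.mem_iff, SimpleGraph.Copy.toHom_apply]
      fin_cases i <;> simp
    · rintro ⟨e, he, hv⟩
      exact f.toSubgraph.mem_verts_of_mem_edge he hv
  refine card_bij (fun G' _ => G'.edgeSet.toFinset) ?_ ?_ ?_
  · intro G' hG'
    obtain ⟨f, -, rfl⟩ := mem_image.1 hG'
    rw [hedge, mem_fourCycles]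
    exact ⟨_, _, _, _, isFourCycle_copy f, rfl⟩
  · intro G₁ h₁ G₂ h₂ h
    obtain ⟨f, -, rfl⟩ := mem_image.1 h₁
    obtain ⟨g, -, rfl⟩ := mem_image.1 h₂
    have h' : f.toSubgraph.edgeSet = g.toSubgraph.edgeSet := Set.toFinset_inj.1 h
    refine SimpleGraph.Subgraph.ext (Set.ext fun v => ?_) ?_
    · rw [hverts, hverts, h']
    · funext x y
      rw [← SimpleGraph.Subgraph.mem_edgeSet, ← SimpleGraph.Subgraph.mem_edgeSet, h']
  · intro F hF
    obtain ⟨a, b, c, d, h, rfl⟩ := mem_fourCycles.1 hF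
    obtain ⟨f, rfl, rfl, rfl, rfl⟩ := h.exists_copy
    exact ⟨f.toSubgraph, mem_image_of_mem _ (mem_univ _), hedge f⟩

/-! ### Cliques with four vertices -/

lemma isNClique_eq_of_k4_le_one [Fintype V] {G : SimpleGraph V} (h : k4 G ≤ 1)
    {s t : Finset V} (hs : G.IsNClique 4 s) (ht : G.IsNClique 4 t) : s = t := by
  classical
  have key : ∀ s : Finset V, G.IsNClique 4 s →
      ∃ f : SimpleGraph.Copy (SimpleGraph.completeGraph (Fin 4)) G,
        f.toSubgraph.verts = (s : Set V) := by
    intro s hs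
    let e := (s.equivFinOfCardEq hs.card_eq).symm
    refine ⟨⟨⟨fun i => e i, fun {i j} hij => ?_⟩,
      fun i j hij => e.injective (Subtype.ext hij)⟩, ?_⟩
    · refine hs.isClique (e i).2 (e j).2 fun h => ?_
      exact hij (e.injective (Subtype.ext h))
    · ext v
      simp only [SimpleGraph.Subgraph.map_verts, SimpleGraph.Subgraph.verts_top, Set.image_univ,
        Set.mem_range, mem_coe]
      constructor
      · rintro ⟨i, rfl⟩; exact (e i).2
      · intro hv; exact ⟨e.symm ⟨v, hv⟩, by simp⟩
  obtain ⟨f, hf⟩ := key s hs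
  obtain ⟨g, hg⟩ := key t ht
  unfold k4 at h
  rw [SimpleGraph.copyCount_eq_card_image_copyToSubgraph, card_le_one] at h
  have := h _ (mem_image_of_mem _ (mem_univ f)) _ (mem_image_of_mem _ (mem_univ g))
  rw [this, hg] at hf
  exact (coe_injective hf).symm

lemma cliqueFree_of_k4_eq_zero [Fintype V] {G : SimpleGraph V} (h : k4 G = 0) :
    G.CliqueFree 4 := by
  rw [k4, SimpleGraph.copyCount_eq_zero] at h
  rw [SimpleGraph.cliqueFree_iff]
  exact ⟨fun f => h ⟨f⟩⟩

lemma isNClique_four [DecidableEq V] {G : SimpleGraph V} {a b c d : V} (hab : G.Adj a b)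
    (hac : G.Adj a c) (had : G.Adj a d) (hbc : G.Adj b c) (hbd : G.Adj b d) (hcd : G.Adj c d) :
    G.IsNClique 4 {a, b, c, d} := by
  refine SimpleGraph.IsNClique.insert (SimpleGraph.is3Clique_triple_iff.2 ⟨hbc, hbd, hcd⟩) ?_
  simp [hab, hac, had]

/-! ### Cyclomatic number and deletion of edges -/

lemma connected_deleteEdges {G : SimpleGraph V} (hG : G.Connected) {S : Set (Sym2 V)}
    (h : ∀ x y, s(x, y) ∈ S → (G.deleteEdges S).Reachable x y) :
    (G.deleteEdges S).Connected := by
  have := hG.nonempty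
  refine ⟨fun u v => ?_⟩
  obtain ⟨p⟩ := hG.preconnected u v
  induction p with
  | nil => exact .rfl
  | @cons x y z hxy p ih =>
    refine SimpleGraph.Reachable.trans ?_ ih
    by_cases hS : s(x, y) ∈ S
    · exact h x y hS
    · exact SimpleGraph.Adj.reachable (SimpleGraph.deleteEdges_adj.2 ⟨hxy, hS⟩)

lemma card_le_ncard_edgeSet [Fintype V] {G : SimpleGraph V} (hG : G.Connected)
    (hb : ¬ G.Colorable 2) : Fintype.card V ≤ G.edgeSet.ncard := by
  have h1 := hG.card_vert_le_card_edgeSet_add_one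
  have h2 : Nat.card G.edgeSet + 1 ≠ Nat.card V := fun h =>
    hb (SimpleGraph.isTree_iff_connected_and_card.2 ⟨hG, h⟩).colorable_two
  rw [Nat.card_coe_set_eq] at h1 h2
  rw [Nat.card_eq_fintype_card] at h1 h2
  omega

/-- A set of edges whose deletion leaves a connected non-bipartite graph is smaller than the
cyclomatic number `g`. -/
lemma ncard_add_one_le [Fintype V] {G : SimpleGraph V} {g : ℕ}
    (hg : G.edgeSet.ncard + 1 = g + Fintype.card V) {S : Set (Sym2 V)} (hS : S ⊆ G.edgeSet)
    (hc : (G.deleteEdges S).Connected) (hb : ¬ (G.deleteEdges S).Colorable 2) :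
    S.ncard + 1 ≤ g := by
  have h1 := card_le_ncard_edgeSet hc hb
  rw [SimpleGraph.edgeSet_deleteEdges] at h1
  have h2 := Set.ncard_sdiff_add_ncard_of_subset hS (Set.toFinite _)
  omega

lemma ncard_edgeSet_deleteEdges [Fintype V] {G : SimpleGraph V} {e : Sym2 V}
    (he : e ∈ G.edgeSet) : (G.deleteEdges {e}).edgeSet.ncard + 1 = G.edgeSet.ncard := by
  rw [SimpleGraph.edgeSet_deleteEdges]
  exact Set.ncard_sdiff_singleton_add_one he (Set.toFinite _)

/-! ### The number of four-cycles through an edge -/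

/-- The `4`-cycles of `G` that contain the edge `e`. -/
noncomputable def cyclesThrough [Fintype V] [DecidableEq V] (G : SimpleGraph V) (e : Sym2 V) :
    Finset (Finset (Sym2 V)) :=
  (fourCycles G).filter (e ∈ ·)

lemma exists_eq_cycleEdges_of_mem [DecidableEq V] [Fintype V] {G : SimpleGraph V}
    {F : Finset (Sym2 V)} (hF : F ∈ fourCycles G) {a b : V} (h : s(a, b) ∈ F) :
    ∃ c d, IsFourCycle G a b c d ∧ F = cycleEdges a b c d := by
  have key : ∀ {w x y z : V}, IsFourCycle G w x y z → s(a, b) = s(w, x) →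
      ∃ c d, IsFourCycle G a b c d ∧ cycleEdges w x y z = cycleEdges a b c d := by
    intro w x y z h hab
    rcases Sym2.eq_iff.1 hab with ⟨rfl, rfl⟩ | ⟨rfl, rfl⟩
    · exact ⟨y, z, h, rfl⟩
    · exact ⟨z, y, h.reflect, (cycleEdges_reflect _ _ _ _).symm⟩
  obtain ⟨w, x, y, z, hc, rfl⟩ := mem_fourCycles.1 hF
  have h' := h
  simp only [cycleEdges, mem_insert, mem_singleton] at h'
  rcases h' with h' | h' | h' | h'
  · exact key hc h'
  · obtain ⟨c, d, h1, h2⟩ := key hc.rotate h'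
    exact ⟨c, d, h1, (cycleEdges_rotate _ _ _ _).symm.trans h2⟩
  · obtain ⟨c, d, h1, h2⟩ := key hc.rotate.rotate h'
    exact ⟨c, d, h1, (cycleEdges_rotate _ _ _ _).symm.trans
      ((cycleEdges_rotate _ _ _ _).symm.trans h2)⟩
  · obtain ⟨c, d, h1, h2⟩ := key hc.rotate.rotate.rotate h'
    exact ⟨c, d, h1, (cycleEdges_rotate _ _ _ _).trans h2⟩

/-- In a connected non-bipartite graph of cyclomatic number `g` with at most one `K₄`, an edge lies
on at most `g - 1` four-cycles. These `4`-cycles are determined by the opposite edges, which can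
all be deleted without disconnecting the graph or making it bipartite; a `K₄` containing the
edge is counted twice, but then one further edge can be deleted. -/
lemma card_cyclesThrough_add_one_le [Fintype V] [DecidableEq V] {G : SimpleGraph V}
    (hG : G.Connected) (hb : ¬ G.Colorable 2) (hk : (G.cliqueSet 4).Subsingleton) {g : ℕ}
    (hg : G.edgeSet.ncard + 1 = g + Fintype.card V) {a b : V} (hab : G.Adj a b) :
    (cyclesThrough G s(a, b)).card + 1 ≤ g := by
  classical
  let P : Finset (V × V) := univ.filter fun p =>
    G.Adj a p.1 ∧ p.1 ≠ b ∧ G.Adj b p.2 ∧ p.2 ≠ a ∧ G.Adj p.1 p.2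
  have hP : ∀ x y, (x, y) ∈ P ↔ G.Adj a x ∧ x ≠ b ∧ G.Adj b y ∧ y ≠ a ∧ G.Adj x y := by
    intro x y; simp [P]
  let E := P.image fun p => s(p.1, p.2)
  have hE : ∀ e, e ∈ E ↔ ∃ x y, (x, y) ∈ P ∧ s(x, y) = e := by
    intro e; simp [E]
  have hEG : (E : Set (Sym2 V)) ⊆ G.edgeSet := by
    intro e he
    obtain ⟨x, y, h, rfl⟩ := (hE e).1 he
    exact ((hP x y).1 h).2.2.2.2
  have hthr : (cyclesThrough G s(a, b)).card ≤ P.card := by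
    refine (card_le_card (t := P.image fun p => cycleEdges a b p.2 p.1) ?_).trans card_image_le
    intro F hF
    obtain ⟨hF, hm⟩ := mem_filter.1 hF
    obtain ⟨y, x, ⟨h1, h2, h3, h4, h5, h6⟩, rfl⟩ := exists_eq_cycleEdges_of_mem hF hm
    exact mem_image.2 ⟨(x, y), (hP x y).2 ⟨h4.symm, h6.symm, h2, h5.symm, h3.symm⟩, rfl⟩
  have haE : ∀ z, s(a, z) ∉ E := by
    intro z hz
    obtain ⟨x, y, h, hxy⟩ := (hE _).1 hz
    obtain ⟨h1, h2, h3, h4, h5⟩ := (hP x y).1 h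
    rcases Sym2.eq_iff.1 hxy with ⟨rfl, rfl⟩ | ⟨rfl, rfl⟩
    · exact h1.ne rfl
    · exact h4 rfl
  have hbE : ∀ z, s(b, z) ∉ E := by
    intro z hz
    obtain ⟨x, y, h, hxy⟩ := (hE _).1 hz
    obtain ⟨h1, h2, h3, h4, h5⟩ := (hP x y).1 h
    rcases Sym2.eq_iff.1 hxy with ⟨rfl, rfl⟩ | ⟨rfl, rfl⟩
    · exact h2 rfl
    · exact h3.ne rfl
  by_cases hK : ∃ x y, (x, y) ∈ P ∧ (y, x) ∈ P
  · obtain ⟨x₀, y₀, h₀, h₀'⟩ := hK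
    obtain ⟨hax, hxb, hby, hya, hxy⟩ := (hP _ _).1 h₀
    obtain ⟨hay, hyb, hbx, hxa, -⟩ := (hP _ _).1 h₀'
    -- only the pair `(x₀, y₀)` is counted twice
    have hcard : P.card ≤ E.card + 1 := by
      rw [← card_erase_add_one h₀]
      refine Nat.add_le_add_right ?_ 1
      refine card_le_card_of_injOn (fun p => s(p.1, p.2)) ?_ ?_
      · intro p hp
        exact mem_image_of_mem _ (mem_of_mem_erase hp)
      · rintro ⟨x, y⟩ hp ⟨x', y'⟩ hp' h
        obtain ⟨hne, hp⟩ := mem_erase.1 hp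
        obtain ⟨hne', hp'⟩ := mem_erase.1 hp'
        rcases Sym2.eq_iff.1 h with ⟨h1, h2⟩ | ⟨h1, h2⟩
        · exact Prod.ext h1 h2
        · exfalso
          dsimp only at h1 h2
          subst h1 h2
          obtain ⟨k1, k2, k3, k4, k5⟩ := (hP _ _).1 hp
          obtain ⟨l1, l2, l3, l4, l5⟩ := (hP _ _).1 hp'
          have := hk (isNClique_four hab hax hay hbx hby hxy)
            (isNClique_four hab k1 l1 l3 k3 k5)
          have hx : x ∈ ({a, b, x₀, y₀} : Finset V) := by rw [this]; simp
          have hy : y ∈ ({a, b, x₀, y₀} : Finset V) := by rw [this]; simp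
          simp only [mem_insert, mem_singleton] at hx hy
          have := k5.ne
          grind
    have hne : s(a, x₀) ∉ E := haE _
    have hS : ((insert s(a, x₀) E : Finset (Sym2 V)) : Set (Sym2 V)).ncard + 1 ≤ g := by
      set S : Set (Sym2 V) := ((insert s(a, x₀) E : Finset (Sym2 V)) : Set (Sym2 V)) with hSdef
      have hmem : ∀ e, e ∈ S ↔ e = s(a, x₀) ∨ e ∈ E := by intro e; simp [hSdef]
      have hA : ∀ z, G.Adj a z → z ≠ x₀ → (G.deleteEdges S).Adj a z := by
        intro z hz hzx
        refine SimpleGraph.deleteEdges_adj.2 ⟨hz, fun h => ?_⟩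
        rcases (hmem _).1 h with h | h
        · rcases Sym2.eq_iff.1 h with ⟨-, h⟩ | ⟨h, -⟩
          · exact hzx h
          · exact hxa h.symm
        · exact haE _ h
      have hB : ∀ z, G.Adj b z → (G.deleteEdges S).Adj b z := by
        intro z hz
        refine SimpleGraph.deleteEdges_adj.2 ⟨hz, fun h => ?_⟩
        rcases (hmem _).1 h with h | h
        · rcases Sym2.eq_iff.1 h with ⟨h, -⟩ | ⟨h, -⟩
          · exact hab.ne h.symm
          · exact hxb h.symm
        · exact hbE _ h
      have hAB : (G.deleteEdges S).Adj a b := hA b hab hxb.symm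
      have hax' : (G.deleteEdges S).Reachable a x₀ := hAB.reachable.trans (hB _ hbx).reachable
      refine ncard_add_one_le hg ?_ (connected_deleteEdges hG ?_) ?_
      · intro e he
        rcases (hmem _).1 he with rfl | h
        · exact hax
        · exact hEG h
      · intro u v huv
        rcases (hmem _).1 huv with h | h
        · rcases Sym2.eq_iff.1 h with ⟨rfl, rfl⟩ | ⟨rfl, rfl⟩
          · exact hax'
          · exact hax'.symm
        · obtain ⟨x, y, hm, he⟩ := (hE _).1 h
          obtain ⟨h1, h2, h3, h4, h5⟩ := (hP x y).1 hm
          have hxy : (G.deleteEdges S).Reachable x y := by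
            refine SimpleGraph.Reachable.trans (v := a) ?_
              (hAB.reachable.trans (hB _ h3).reachable)
            by_cases hxx : x = x₀
            · exact hxx ▸ hax'.symm
            · exact (hA x h1 hxx).symm.reachable
          rcases Sym2.eq_iff.1 he with ⟨rfl, rfl⟩ | ⟨rfl, rfl⟩
          · exact hxy
          · exact hxy.symm
      · rintro ⟨c⟩
        have h1 := c.valid hAB
        have h2 := c.valid (hB _ hby)
        have h3 := c.valid (hA _ hay hxy.ne.symm)
        omega
    rw [Set.ncard_coe_finset, card_insert_of_notMem hne] at hS
    omega
  · have hcard : P.card ≤ E.card := by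
      refine card_le_card_of_injOn (fun p => s(p.1, p.2)) (fun p hp => mem_image_of_mem _ hp) ?_
      rintro ⟨x, y⟩ hp ⟨x', y'⟩ hp' h
      rcases Sym2.eq_iff.1 h with ⟨h1, h2⟩ | ⟨h1, h2⟩
      · exact Prod.ext h1 h2
      · dsimp only at h1 h2
        subst h1 h2
        exact absurd ⟨_, _, hp, hp'⟩ hK
    have hA : ∀ z, G.Adj a z → (G.deleteEdges E).Adj a z := fun z hz =>
      SimpleGraph.deleteEdges_adj.2 ⟨hz, haE z⟩
    have hB : ∀ z, G.Adj b z → (G.deleteEdges E).Adj b z := fun z hz =>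
      SimpleGraph.deleteEdges_adj.2 ⟨hz, hbE z⟩
    have hS : (E : Set (Sym2 V)).ncard + 1 ≤ g := by
      refine ncard_add_one_le hg hEG (connected_deleteEdges hG ?_) ?_
      · intro u v huv
        obtain ⟨x, y, hm, he⟩ := (hE _).1 huv
        obtain ⟨h1, h2, h3, h4, h5⟩ := (hP x y).1 hm
        have hxy : (G.deleteEdges E).Reachable x y :=
          (hA x h1).symm.reachable.trans ((hA b hab).reachable.trans (hB y h3).reachable)
        rcases Sym2.eq_iff.1 he with ⟨rfl, rfl⟩ | ⟨rfl, rfl⟩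
        · exact hxy
        · exact hxy.symm
      -- a `2`-colouring after the deletion is proper for the deleted edges as well
      · rintro ⟨c⟩
        refine hb ⟨SimpleGraph.Coloring.mk c fun {u v} huv => ?_⟩
        by_cases hE' : s(u, v) ∈ E
        · obtain ⟨x, y, hm, he⟩ := (hE _).1 hE'
          obtain ⟨h1, h2, h3, h4, h5⟩ := (hP x y).1 hm
          have e1 := c.valid (hA x h1)
          have e2 := c.valid (hA b hab)
          have e3 := c.valid (hB y h3)
          rcases Sym2.eq_iff.1 he with ⟨rfl, rfl⟩ | ⟨rfl, rfl⟩ <;> omega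
        · exact c.valid (SimpleGraph.deleteEdges_adj.2 ⟨huv, hE'⟩)
    rw [Set.ncard_coe_finset] at hS
    omega

/-! ### The inequality -/

lemma cliqueSet_subsingleton_mono {G H : SimpleGraph V} (h : G ≤ H) {n : ℕ}
    (hk : (H.cliqueSet n).Subsingleton) : (G.cliqueSet n).Subsingleton :=
  hk.anti (SimpleGraph.cliqueSet_mono h)

lemma fourCycles_deleteEdges [Fintype V] [DecidableEq V] (G : SimpleGraph V) (e : Sym2 V) :
    fourCycles (G.deleteEdges {e}) = (fourCycles G).filter (e ∉ ·) := by
  ext F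
  simp only [mem_filter, mem_fourCycles]
  constructor
  · rintro ⟨a, b, c, d, h, rfl⟩
    refine ⟨⟨a, b, c, d, h.mono (SimpleGraph.deleteEdges_le _), rfl⟩, fun he => ?_⟩
    have := h.mem_edgeSet he
    simp at this
  · rintro ⟨⟨a, b, c, d, ⟨h1, h2, h3, h4, h5⟩, rfl⟩, he⟩
    simp only [cycleEdges, mem_insert, mem_singleton, not_or] at he
    obtain ⟨e1, e2, e3, e4⟩ := he
    refine ⟨a, b, c, d, ⟨?_, ?_, ?_, ?_, h5⟩, rfl⟩ <;>
      simp only [SimpleGraph.deleteEdges_adj, Set.mem_singleton_iff]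
    · exact ⟨h1, Ne.symm e1⟩
    · exact ⟨h2, Ne.symm e2⟩
    · exact ⟨h3, Ne.symm e3⟩
    · exact ⟨h4, Ne.symm e4⟩

lemma card_fourCycles_eq_add [Fintype V] [DecidableEq V] (G : SimpleGraph V) (e : Sym2 V) :
    (fourCycles G).card =
      (cyclesThrough G e).card + (fourCycles (G.deleteEdges {e})).card := by
  rw [fourCycles_deleteEdges, cyclesThrough, card_filter_add_card_filter_not]

/-- Deleting an edge `ab` of a `4`-cycle keeps a connected non-bipartite graph connected and
non-bipartite, because a path of length three from `a` to `b` remains. -/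
lemma IsFourCycle.connected_deleteEdges {G : SimpleGraph V} (hG : G.Connected)
    (hb : ¬ G.Colorable 2) {a b c d : V} (h : IsFourCycle G a b c d) :
    (G.deleteEdges {s(a, b)}).Connected ∧ ¬ (G.deleteEdges {s(a, b)}).Colorable 2 := by
  obtain ⟨h1, h2, h3, h4, h5, h6⟩ := h
  have := h1.ne; have := h2.ne; have := h3.ne; have := h4.ne
  have k2 : (G.deleteEdges {s(a, b)}).Adj b c := by
    simp only [SimpleGraph.deleteEdges_adj, Set.mem_singleton_iff, Sym2.eq_iff]; grind
  have k3 : (G.deleteEdges {s(a, b)}).Adj c d := by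
    simp only [SimpleGraph.deleteEdges_adj, Set.mem_singleton_iff, Sym2.eq_iff]; grind
  have k4 : (G.deleteEdges {s(a, b)}).Adj d a := by
    simp only [SimpleGraph.deleteEdges_adj, Set.mem_singleton_iff, Sym2.eq_iff]; grind
  have hr : (G.deleteEdges {s(a, b)}).Reachable a b :=
    (k2.reachable.trans (k3.reachable.trans k4.reachable)).symm
  refine ⟨hG.connected_delete_edge_of_not_isBridge fun hbr =>
    SimpleGraph.isBridge_iff.1 hbr hr, ?_⟩
  rintro ⟨col⟩
  refine hb ⟨SimpleGraph.Coloring.mk col fun {u v} huv => ?_⟩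
  by_cases he : s(u, v) = s(a, b)
  · have e1 := col.valid k2
    have e2 := col.valid k3
    have e3 := col.valid k4
    rcases Sym2.eq_iff.1 he with ⟨rfl, rfl⟩ | ⟨rfl, rfl⟩ <;> omega
  · exact col.valid (SimpleGraph.deleteEdges_adj.2 ⟨huv, he⟩)

lemma choose_two_succ (n : ℕ) : (n + 1).choose 2 = n + n.choose 2 := by
  rw [Nat.choose_succ_succ' n 1, Nat.choose_one_right]

theorem card_fourCycles_le [Fintype V] [DecidableEq V] {g : ℕ} : ∀ {G : SimpleGraph V},
    G.Connected → ¬ G.Colorable 2 → (G.cliqueSet 4).Subsingleton →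
    G.edgeSet.ncard + 1 = g + Fintype.card V → (fourCycles G).card ≤ g.choose 2 := by
  induction g with
  | zero =>
    intro G hG hb hk hg
    have := card_le_ncard_edgeSet hG hb
    omega
  | succ g ih =>
    intro G hG hb hk hg
    rcases (fourCycles G).eq_empty_or_nonempty with h | ⟨F, hF⟩
    · simp [h]
    · obtain ⟨a, b, c, d, h, -⟩ := mem_fourCycles.1 hF
      obtain ⟨hG', hb'⟩ := h.connected_deleteEdges hG hb
      have h1 := ncard_edgeSet_deleteEdges (G := G) (e := s(a, b)) h.1
      have h2 := ih hG' hb' (cliqueSet_subsingleton_mono (SimpleGraph.deleteEdges_le _) hk)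
        (by omega)
      have h3 := card_cyclesThrough_add_one_le hG hb hk hg h.1
      rw [card_fourCycles_eq_add G s(a, b), choose_two_succ]
      omega

/-! ### Graphs attaining equality contain a large complete bipartite graph -/

/-- A connected non-bipartite `K₄`-free graph of cyclomatic number `g` with `g.choose 2`
four-cycles. -/
structure IsExtremal [Fintype V] [DecidableEq V] (G : SimpleGraph V) (g : ℕ) : Prop where
  connected : G.Connected
  not_colorable : ¬ G.Colorable 2
  cliqueFree : G.CliqueFree 4
  cyclomatic : G.edgeSet.ncard + 1 = g + Fintype.card V
  card_eq : (fourCycles G).card = g.choose 2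

lemma cliqueSet_subsingleton_of_cliqueFree {G : SimpleGraph V} {n : ℕ} (h : G.CliqueFree n) :
    (G.cliqueSet n).Subsingleton := by
  rw [SimpleGraph.cliqueSet_eq_empty_iff.2 h]; exact Set.subsingleton_empty

/-- In an extremal graph, every edge on a `4`-cycle attains the bound for the number of `4`-cycles
through an edge, and its deletion leaves an extremal graph. -/
lemma IsExtremal.step [Fintype V] [DecidableEq V] {G : SimpleGraph V} {g : ℕ}
    (h : IsExtremal G (g + 1)) {a b c d : V} (hc : IsFourCycle G a b c d) :
    (cyclesThrough G s(a, b)).card = g ∧ IsExtremal (G.deleteEdges {s(a, b)}) g := by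
  obtain ⟨hG', hb'⟩ := hc.connected_deleteEdges h.connected h.not_colorable
  have h1 := ncard_edgeSet_deleteEdges (G := G) (e := s(a, b)) hc.1
  have hle := SimpleGraph.deleteEdges_le (G := G) {s(a, b)}
  have hk := cliqueSet_subsingleton_of_cliqueFree h.cliqueFree
  have h0 := h.cyclomatic
  have hcyc : (G.deleteEdges {s(a, b)}).edgeSet.ncard + 1 = g + Fintype.card V := by omega
  have h2 := card_fourCycles_le hG' hb' (cliqueSet_subsingleton_mono hle hk) hcyc
  have h3 := card_cyclesThrough_add_one_le h.connected h.not_colorable hk h.cyclomatic hc.1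
  have h4 := h.card_eq
  rw [card_fourCycles_eq_add G s(a, b), choose_two_succ] at h4
  exact ⟨by omega, hG', hb', h.cliqueFree.anti hle, hcyc, by omega⟩

/-- The edges of `G` that lie on a `4`-cycle. -/
noncomputable def cycleSupport [Fintype V] [DecidableEq V] (G : SimpleGraph V) :
    Finset (Sym2 V) :=
  (fourCycles G).biUnion id

lemma mem_cycleSupport [Fintype V] [DecidableEq V] {G : SimpleGraph V} {e : Sym2 V} :
    e ∈ cycleSupport G ↔ ∃ F ∈ fourCycles G, e ∈ F := by
  simp [cycleSupport]

lemma exists_isFourCycle_of_mem_cycleSupport [Fintype V] [DecidableEq V] {G : SimpleGraph V}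
    {a b : V} (h : s(a, b) ∈ cycleSupport G) : ∃ c d, IsFourCycle G a b c d := by
  obtain ⟨F, hF, he⟩ := mem_cycleSupport.1 h
  obtain ⟨c, d, h, -⟩ := exists_eq_cycleEdges_of_mem hF he
  exact ⟨c, d, h⟩

lemma sum_card_cyclesThrough [Fintype V] [DecidableEq V] (G : SimpleGraph V) :
    ∑ e ∈ cycleSupport G, (cyclesThrough G e).card = (fourCycles G).card * 4 := by
  have h := sum_card_bipartiteAbove_eq_sum_card_bipartiteBelow (s := cycleSupport G)
    (t := fourCycles G) (r := fun e F => e ∈ F)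
  have h1 : ∀ F ∈ fourCycles G,
      (bipartiteBelow (fun e F => e ∈ F) (cycleSupport G) F).card = 4 := by
    intro F hF
    have : bipartiteBelow (fun e F => e ∈ F) (cycleSupport G) F = F := by
      ext e
      simp only [mem_bipartiteBelow, mem_cycleSupport]
      exact ⟨fun h => h.2, fun h => ⟨⟨F, hF, h⟩, h⟩⟩
    rw [this]
    obtain ⟨a, b, c, d, h, rfl⟩ := mem_fourCycles.1 hF
    exact h.card_cycleEdges
  rw [sum_congr rfl h1, sum_const, smul_eq_mul] at h
  exact h

lemma IsExtremal.card_cycleSupport [Fintype V] [DecidableEq V] {G : SimpleGraph V} {g : ℕ}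
    (h : IsExtremal G (g + 2)) : (cycleSupport G).card = 2 * (g + 2) := by
  have h1 := sum_card_cyclesThrough G
  rw [sum_congr rfl (g := fun _ => g + 1), sum_const, smul_eq_mul, h.card_eq] at h1
  · have h2 : (g + 2).choose 2 * 2 = (g + 2) * (g + 1) := by
      rw [Nat.choose_two_right, Nat.div_mul_cancel]
      · simp
      · simpa using (Nat.even_mul_pred_self (g + 2)).two_dvd
    refine Nat.eq_of_mul_eq_mul_right (Nat.succ_pos g) ?_
    rw [Nat.succ_eq_add_one, h1]
    linarith
  · intro e he
    induction e with | h a b =>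
    obtain ⟨c, d, hc⟩ := exists_isFourCycle_of_mem_cycleSupport he
    exact (h.step hc).1

/-- If every `4`-cycle through `ab` also contains `bc`, then these `4`-cycles are given by the
common neighbours of `a` and `c` other than `b`. -/
lemma card_cyclesThrough_add_one_le_of_adjacent [Fintype V] [DecidableEq V] {G : SimpleGraph V}
    {a b c d : V} (hc : IsFourCycle G a b c d)
    (h : cyclesThrough G s(a, b) ⊆ cyclesThrough G s(b, c)) :
    ∃ Z : Finset V, (∀ z ∈ Z, G.Adj a z ∧ G.Adj c z) ∧
      (cyclesThrough G s(a, b)).card + 1 ≤ Z.card := by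
  classical
  obtain ⟨h1, h2, h3, h4, h5, h6⟩ := hc
  refine ⟨univ.filter fun z => G.Adj a z ∧ G.Adj c z, by simp, ?_⟩
  have hb : b ∈ univ.filter fun z => G.Adj a z ∧ G.Adj c z := by simp [h1, h2.symm]
  rw [← card_erase_add_one hb]
  refine Nat.add_le_add_right ((card_le_card (t := image (fun w => cycleEdges a b c w) _) ?_).trans
    card_image_le) 1
  intro F hF
  have hF' := (mem_filter.1 (h hF)).2
  obtain ⟨hF, hm⟩ := mem_filter.1 hF
  obtain ⟨x, y, hx, rfl⟩ := exists_eq_cycleEdges_of_mem hF hm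
  obtain ⟨k1, k2, k3, k4, k5, k6⟩ := hx
  have hxc : x = c := by
    have := k1.ne; have := k2.ne; have := k3.ne; have := k4.ne
    have := h1.ne; have := h2.ne
    simp only [cycleEdges, mem_insert, mem_singleton, Sym2.eq_iff] at hF'
    grind
  subst hxc
  exact mem_image.2 ⟨y, by simp [k6.symm, k4.symm, k3], rfl⟩

/-- Opposite edges `ab` and `cd` lie together only on the `4`-cycles `abcd` and `abdc`, and
these two exist simultaneously only in a `K₄`. -/
lemma card_cyclesThrough_le_one_of_opposite [Fintype V] [DecidableEq V] {G : SimpleGraph V}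
    (hk : G.CliqueFree 4) {a b c d : V} (hc : IsFourCycle G a b c d)
    (h : cyclesThrough G s(a, b) ⊆ cyclesThrough G s(c, d)) :
    (cyclesThrough G s(a, b)).card ≤ 1 := by
  obtain ⟨h1, h2, h3, h4, h5, h6⟩ := hc
  refine (card_le_card (t := {cycleEdges a b c d}) ?_).trans (by simp)
  intro F hF
  have hF' := (mem_filter.1 (h hF)).2
  obtain ⟨hF, hm⟩ := mem_filter.1 hF
  obtain ⟨x, y, hx, rfl⟩ := exists_eq_cycleEdges_of_mem hF hm
  obtain ⟨k1, k2, k3, k4, k5, k6⟩ := hx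
  have hxy : x = c ∧ y = d ∨ x = d ∧ y = c := by
    have := k1.ne; have := k2.ne; have := k3.ne; have := k4.ne
    have := h1.ne; have := h2.ne; have := h3.ne; have := h4.ne
    simp only [cycleEdges, mem_insert, mem_singleton, Sym2.eq_iff] at hF'
    grind
  rcases hxy with ⟨rfl, rfl⟩ | ⟨rfl, rfl⟩
  · simp
  · exact absurd (isNClique_four h1 k4.symm h4.symm h2 k2 h3) (hk _)

/-- An extremal graph of cyclomatic number `g ≥ 2` has two vertices with `g` common
neighbours. For `g ≥ 3`, deleting an edge `e` of a `4`-cycle lowers the number of edges on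
`4`-cycles from `2 * g` to `2 * (g - 1)`. So besides `e` exactly one edge `f` ceases
to lie on a `4`-cycle; it lies on the same `4`-cycles as `e`. -/
lemma IsExtremal.exists_common_neighbors [Fintype V] [DecidableEq V] {G : SimpleGraph V} {g : ℕ}
    (h : IsExtremal G (g + 2)) :
    ∃ p q : V, p ≠ q ∧ ∃ Z : Finset V, (∀ z ∈ Z, G.Adj p z ∧ G.Adj q z) ∧ Z.card = g + 2 := by
  classical
  suffices H : ∃ p q : V, p ≠ q ∧ ∃ Z : Finset V, (∀ z ∈ Z, G.Adj p z ∧ G.Adj q z) ∧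
      g + 2 ≤ Z.card by
    obtain ⟨p, q, hpq, Z, hZ, hcard⟩ := H
    obtain ⟨Z', hZ', hcard'⟩ := exists_subset_card_eq hcard
    exact ⟨p, q, hpq, Z', fun z hz => hZ z (hZ' hz), hcard'⟩
  have hpos : (fourCycles G).Nonempty := by
    rw [← card_pos, h.card_eq]; exact Nat.choose_pos (by omega)
  obtain ⟨F, hF⟩ := hpos
  obtain ⟨a, b, c, d, hc, rfl⟩ := mem_fourCycles.1 hF
  rcases g with _ | g
  · obtain ⟨h1, h2, h3, h4, h5, h6⟩ := hc
    refine ⟨a, c, h5, {b, d}, ?_, ?_⟩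
    · simp [h1, h2.symm, h3, h4.symm]
    · rw [card_pair h6]
  obtain ⟨hcard, hext⟩ := h.step hc
  have hs := h.card_cycleSupport
  have hs' := hext.card_cycleSupport
  have hmem : s(a, b) ∈ cycleSupport G := mem_cycleSupport.2 ⟨_, hF, by simp [cycleEdges]⟩
  -- another edge `f` lies on `4`-cycles only together with `ab`
  obtain ⟨f, hf, hf'⟩ : ∃ f ∈ (cycleSupport G).erase s(a, b),
      f ∉ cycleSupport (G.deleteEdges {s(a, b)}) := by
    by_contra! hcon
    have := card_le_card hcon
    rw [card_erase_of_mem hmem] at this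
    omega
  obtain ⟨hfne, hf⟩ := mem_erase.1 hf
  have hsub : cyclesThrough G f ⊆ cyclesThrough G s(a, b) := by
    intro F' hF'
    obtain ⟨hF', hfF⟩ := mem_filter.1 hF'
    refine mem_filter.2 ⟨hF', ?_⟩
    by_contra hcon
    refine hf' (mem_cycleSupport.2 ⟨F', ?_, hfF⟩)
    rw [fourCycles_deleteEdges]
    exact mem_filter.2 ⟨hF', hcon⟩
  have hfcard : (cyclesThrough G f).card = g + 2 := by
    clear hf' hfne hsub
    induction f with | h x y =>
    obtain ⟨z, w, hz⟩ := exists_isFourCycle_of_mem_cycleSupport hf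
    exact (h.step hz).1
  have heq : cyclesThrough G f = cyclesThrough G s(a, b) :=
    eq_of_subset_of_card_le hsub (by omega)
  obtain ⟨F', hF', hfF⟩ := mem_cycleSupport.1 hf
  have hab : s(a, b) ∈ F' := (mem_filter.1 (hsub (mem_filter.2 ⟨hF', hfF⟩))).2
  obtain ⟨x, y, hx, rfl⟩ := exists_eq_cycleEdges_of_mem hF' hab
  simp only [cycleEdges, mem_insert, mem_singleton] at hfF
  rcases hfF with rfl | rfl | rfl | rfl
  · exact absurd rfl hfne
  · obtain ⟨Z, hZ, hZc⟩ := card_cyclesThrough_add_one_le_of_adjacent hx heq.ge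
    exact ⟨a, x, hx.2.2.2.2.1, Z, hZ, by omega⟩
  · have := card_cyclesThrough_le_one_of_opposite h.cliqueFree hx heq.ge
    omega
  · rw [Sym2.eq_swap (a := y), Sym2.eq_swap (a := a) (b := b)] at heq
    obtain ⟨Z, hZ, hZc⟩ := card_cyclesThrough_add_one_le_of_adjacent hx.reflect heq.ge
    rw [Sym2.eq_swap] at hZc
    exact ⟨b, y, hx.2.2.2.2.2, Z, hZ, by omega⟩

/-- Two vertices with `m` common neighbours give `m.choose 2` four-cycles. -/
lemma choose_two_le_card_fourCycles [Fintype V] [DecidableEq V] {G : SimpleGraph V} {p q : V}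
    (hpq : p ≠ q) {Z : Finset V} (hZ : ∀ z ∈ Z, G.Adj p z ∧ G.Adj q z) :
    Z.card.choose 2 ≤ (fourCycles G).card := by
  rw [← card_powersetCard]
  refine card_le_card_of_injOn (fun s => s.biUnion fun z => {s(p, z), s(z, q)}) ?_ ?_
  · intro s hs
    obtain ⟨hsZ, hs2⟩ := mem_powersetCard.1 hs
    obtain ⟨x, y, hxy, rfl⟩ := card_eq_two.1 hs2
    have hx := hZ x (hsZ (by simp))
    have hy := hZ y (hsZ (by simp))
    refine mem_fourCycles.2 ⟨p, x, q, y, ⟨hx.1, hx.2.symm, hy.2, hy.1.symm, hpq, hxy⟩, ?_⟩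
    ext e
    simp only [cycleEdges, mem_biUnion, mem_insert, mem_singleton, exists_eq_or_imp,
      exists_eq_left, Sym2.eq_swap (a := q) (b := y), Sym2.eq_swap (a := y) (b := p)]
    tauto
  · intro s hs t ht hst
    have key : ∀ u : Finset V, u ⊆ Z → ∀ z,
        z ∈ u ↔ s(p, z) ∈ u.biUnion (fun z => ({s(p, z), s(z, q)} : Finset (Sym2 V))) := by
      intro u hu z
      simp only [mem_biUnion, mem_insert, mem_singleton, Sym2.eq_iff]
      constructor
      · intro hz; exact ⟨z, hz, by simp⟩
      · rintro ⟨w, hw, h⟩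
        have h1 := (hZ w (hu hw)).1.ne
        have h2 := (hZ w (hu hw)).2.ne
        grind
    dsimp only at hst
    ext z
    rw [key s (mem_powersetCard.1 hs).1, key t (mem_powersetCard.1 ht).1, hst]

/-! ### Subgraphs that exhaust a graph without leaves -/

/-- Let `G` be connected without vertices of degree one. A nonempty subgraph `H` missing at most as
many edges as vertices is all of `G`: otherwise the degrees of the missing vertices
sum to at least twice their number, but to less than twice the number of missing edges, because
some missing edge has only one end outside of `H`. -/
lemma eq_top_of_ncard_le [Fintype V] {G : SimpleGraph V} [DecidableRel G.Adj]
    (hG : G.Connected) (hdeg : ∀ v, G.degree v ≠ 1) {H : G.Subgraph} (hne : H.verts.Nonempty)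
    (hcard : G.edgeSet.ncard + H.verts.ncard ≤ H.edgeSet.ncard + Fintype.card V) : H = ⊤ := by
  classical
  have hadj : ∀ x y, H.Adj x y ↔ s(x, y) ∈ H.edgeSet := fun x y => Iff.rfl
  have hsub : H.edgeSet ⊆ G.edgeSet := H.edgeSet_subset
  have hdiff := Set.ncard_sdiff_add_ncard_of_subset hsub (Set.toFinite _)
  have hvdiff := Set.ncard_add_ncard_compl H.verts
  rw [Nat.card_eq_fintype_card] at hvdiff
  have hverts : H.verts = Set.univ := by
    by_contra hcon
    obtain ⟨u, hu⟩ := (Set.ne_univ_iff_exists_notMem _).1 hcon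
    obtain ⟨w, hw⟩ := hne
    have hnt : Nontrivial V := ⟨u, w, fun h => hu (h ▸ hw)⟩
    let U : Finset V := univ.filter (· ∉ H.verts)
    let T : Finset (Sym2 V) := G.edgeFinset.filter (· ∉ H.edgeSet)
    have hU : U.card = H.vertsᶜ.ncard := by
      rw [← Set.ncard_coe_finset]; congr 1; ext; simp [U]
    have hT : T.card = (G.edgeSet \ H.edgeSet).ncard := by
      rw [← Set.ncard_coe_finset]; congr 1; ext; simp [T]
    have hsum := sum_card_bipartiteAbove_eq_sum_card_bipartiteBelow (s := U) (t := T)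
      (r := fun u e => u ∈ e)
    have h1 : U.card * 2 ≤ ∑ u ∈ U, (bipartiteAbove (fun u e => u ∈ e) T u).card := by
      rw [← smul_eq_mul, ← sum_const]
      refine sum_le_sum fun u hu => ?_
      have hu' : u ∉ H.verts := by simpa [U] using hu
      have : bipartiteAbove (fun u e => u ∈ e) T u = G.incidenceFinset u := by
        ext e
        simp only [mem_bipartiteAbove, T, mem_filter, SimpleGraph.mem_edgeFinset,
          SimpleGraph.mem_incidenceFinset, SimpleGraph.incidenceSet, Set.mem_ofPred_eq]
        exact ⟨fun h => ⟨h.1.1, h.2⟩,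
          fun h => ⟨⟨h.1, fun he => hu' (H.mem_verts_of_mem_edge he h.2)⟩, h.2⟩⟩
      rw [this, SimpleGraph.card_incidenceFinset_eq_degree]
      have h2 := hG.preconnected.degree_pos_of_nontrivial u
      have h3 := hdeg u
      omega
    have hle2 : ∀ e ∈ T, (bipartiteBelow (fun u e => u ∈ e) U e).card ≤ 2 := by
      intro e he
      induction e with | h x y =>
      refine (card_le_card (t := {x, y}) fun z hz => ?_).trans card_le_two
      simpa using (mem_bipartiteBelow _).1 hz |>.2
    have h2 : ∑ e ∈ T, (bipartiteBelow (fun u e => u ∈ e) U e).card < T.card * 2 := by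
      rw [← smul_eq_mul, ← sum_const]
      refine sum_lt_sum hle2 ?_
      obtain ⟨p⟩ := hG.preconnected w u
      obtain ⟨d, -, hd1, hd2⟩ := p.exists_boundary_dart H.verts hw hu
      refine ⟨s(d.fst, d.snd), ?_, ?_⟩
      · simp only [T, mem_filter, SimpleGraph.mem_edgeFinset]
        exact ⟨d.adj, fun he => hd2 (H.edge_vert (SimpleGraph.Subgraph.Adj.symm he))⟩
      · refine (Nat.lt_succ_of_le (card_le_one.2 fun x hx y hy => ?_))
        have key : ∀ z ∈ bipartiteBelow (fun u e => u ∈ e) U s(d.fst, d.snd), z = d.snd := by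
          intro z hz
          obtain ⟨hz1, hz2⟩ := (mem_bipartiteBelow _).1 hz
          have hz1 : z ∉ H.verts := by simpa [U] using hz1
          rcases Sym2.mem_iff.1 hz2 with rfl | rfl
          · exact absurd hd1 hz1
          · rfl
        rw [key x hx, key y hy]
    omega
  have hE : H.edgeSet = G.edgeSet := by
    refine Set.eq_of_subset_of_ncard_le hsub ?_ (Set.toFinite _)
    rw [hverts, Set.ncard_univ, Nat.card_eq_fintype_card] at hcard
    omega
  refine SimpleGraph.Subgraph.ext hverts ?_
  funext x y
  rw [hadj, hE]; rfl

/-! ### Nonseparable subgraphs -/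

/-- A connected subgraph without a cut vertex; the blocks of `G` are the maximal ones. -/
def IsNonseparable {G : SimpleGraph V} (H : G.Subgraph) : Prop :=
  H.Connected ∧ ∀ x ∈ H.verts, (H.deleteVerts {x}).Preconnected

lemma exists_isBlock_ge [Finite V] {G : SimpleGraph V} {H : G.Subgraph} (h : IsNonseparable H) :
    ∃ B, H ≤ B ∧ IsBlock G B :=
  Finite.exists_le_maximal (p := IsNonseparable) h

lemma preconnected_of_forall_exists_walk {G : SimpleGraph V} {H : G.Subgraph} (w : V)
    (h : ∀ u ∈ H.verts, ∃ p : G.Walk u w, p.toSubgraph ≤ H) : H.Preconnected := by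
  rw [SimpleGraph.Subgraph.preconnected_iff_forall_exists_walk_subgraph]
  intro u v hu hv
  obtain ⟨p, hp⟩ := h u hu
  obtain ⟨q, hq⟩ := h v hv
  refine ⟨p.append q.reverse, ?_⟩
  rw [SimpleGraph.Walk.toSubgraph_append, SimpleGraph.Walk.toSubgraph_reverse]
  exact sup_le hp hq

lemma le_deleteVerts {G : SimpleGraph V} {A B : G.Subgraph} (h : A ≤ B) {z : V}
    (hz : z ∉ A.verts) : A ≤ B.deleteVerts {z} := by
  refine ⟨fun x hx => ⟨h.1 hx, fun hxz => hz (hxz ▸ hx)⟩, fun x y hxy => ?_⟩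
  have hx := A.edge_vert hxy
  have hy := A.edge_vert hxy.symm
  exact SimpleGraph.Subgraph.deleteVerts_adj.2
    ⟨h.1 hx, fun e => hz (e ▸ hx), h.1 hy, fun e => hz (e ▸ hy), h.2 hxy⟩

lemma IsNonseparable.preconnected_deleteVerts {G : SimpleGraph V} {H : G.Subgraph}
    (h : IsNonseparable H) (z : V) : (H.deleteVerts {z}).Preconnected := by
  by_cases hz : z ∈ H.verts
  · exact h.2 z hz
  · have : H.deleteVerts {z} = H :=
      le_antisymm SimpleGraph.Subgraph.deleteVerts_le (le_deleteVerts le_rfl hz)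
    rw [this]; exact h.1.preconnected

lemma IsNonseparable.exists_walk_avoiding {G : SimpleGraph V} {H : G.Subgraph}
    (h : IsNonseparable H) {x y z : V} (hx : x ∈ H.verts) (hy : y ∈ H.verts) (hxz : x ≠ z)
    (hyz : y ≠ z) : ∃ p : G.Walk x y, z ∉ p.support := by
  obtain ⟨p, hp⟩ := (SimpleGraph.Subgraph.preconnected_iff_forall_exists_walk_subgraph _).1
    (h.preconnected_deleteVerts z) (u := x) (v := y) ⟨hx, hxz⟩ ⟨hy, hyz⟩
  refine ⟨p, fun hz => ?_⟩
  exact (hp.1 ((SimpleGraph.Walk.mem_verts_toSubgraph p).2 hz)).2 rfl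

/-- Nonseparable subgraphs with two common vertices have a nonseparable union. -/
lemma IsNonseparable.sup {G : SimpleGraph V} {A B : G.Subgraph} (hA : IsNonseparable A)
    (hB : IsNonseparable B) {x y : V} (hxy : x ≠ y) (hxA : x ∈ A.verts) (hxB : x ∈ B.verts)
    (hyA : y ∈ A.verts) (hyB : y ∈ B.verts) : IsNonseparable (A ⊔ B) := by
  refine ⟨SimpleGraph.Subgraph.connected_sup hA.1.preconnected hB.1.preconnected ⟨x, hxA, hxB⟩,
    fun z _ => ?_⟩
  have hsup : (A ⊔ B).deleteVerts {z} = A.deleteVerts {z} ⊔ B.deleteVerts {z} := by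
    have hle : (A ⊔ B).deleteVerts {z} ≤ A.deleteVerts {z} ⊔ B.deleteVerts {z} := by
      refine ⟨?_, ?_⟩
      · rintro v ⟨hv | hv, hvz⟩
        · exact Or.inl ⟨hv, hvz⟩
        · exact Or.inr ⟨hv, hvz⟩
      · intro u v huv
        obtain ⟨-, hu, -, hv, h⟩ := SimpleGraph.Subgraph.deleteVerts_adj.1 huv
        rcases h with h | h
        · exact Or.inl (SimpleGraph.Subgraph.deleteVerts_adj.2
            ⟨A.edge_vert h, hu, A.edge_vert h.symm, hv, h⟩)
        · exact Or.inr (SimpleGraph.Subgraph.deleteVerts_adj.2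
            ⟨B.edge_vert h, hu, B.edge_vert h.symm, hv, h⟩)
    exact le_antisymm hle (sup_le (SimpleGraph.Subgraph.deleteVerts_mono le_sup_left)
      (SimpleGraph.Subgraph.deleteVerts_mono le_sup_right))
  rw [hsup]
  obtain ⟨w, hw, hwA, hwB⟩ : ∃ w, w ≠ z ∧ w ∈ A.verts ∧ w ∈ B.verts := by
    by_cases h : x = z
    · exact ⟨y, fun h' => hxy (h.trans h'.symm), hyA, hyB⟩
    · exact ⟨x, h, hxA, hxB⟩
  exact (SimpleGraph.Subgraph.connected_sup (hA.preconnected_deleteVerts z)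
    (hB.preconnected_deleteVerts z) ⟨w, ⟨hwA, hw⟩, ⟨hwB, hw⟩⟩).preconnected

lemma IsBlock.le_of_two_common {G : SimpleGraph V} {A B : G.Subgraph} (hB : IsBlock G B)
    (hA : IsNonseparable A) {x y : V} (hxy : x ≠ y) (hxA : x ∈ A.verts) (hxB : x ∈ B.verts)
    (hyA : y ∈ A.verts) (hyB : y ∈ B.verts) : A ≤ B :=
  le_sup_left.trans (hB.le_of_ge (IsNonseparable.sup hA hB.prop hxy hxA hxB hyA hyB) le_sup_right)

lemma isNonseparable_subgraphOfAdj {G : SimpleGraph V} {u v : V} (h : G.Adj u v) :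
    IsNonseparable (G.subgraphOfAdj h) := by
  refine ⟨SimpleGraph.Subgraph.subgraphOfAdj_connected h, fun x hx => ?_⟩
  obtain ⟨w, hw⟩ : ∃ w, ∀ y ∈ ((G.subgraphOfAdj h).deleteVerts {x}).verts, y = w := by
    rcases hx with rfl | hx
    · refine ⟨v, ?_⟩
      rintro y ⟨rfl | hy, hyx⟩
      · exact absurd rfl hyx
      · exact hy
    · refine ⟨u, ?_⟩
      rintro y ⟨hy | hy, hyx⟩
      · exact hy
      · exact absurd (Eq.trans hy (Eq.symm hx)) hyx
  refine preconnected_of_forall_exists_walk w fun y hy => ?_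
  obtain rfl := hw y hy
  refine ⟨.nil, ?_⟩
  simpa using hy

lemma isNonseparable_toSubgraph_of_isCycle {G : SimpleGraph V} {v : V} {c : G.Walk v v}
    (hc : c.IsCycle) : IsNonseparable c.toSubgraph := by
  classical
  refine ⟨c.toSubgraph_connected, fun x hx => ?_⟩
  have hx' := (SimpleGraph.Walk.mem_verts_toSubgraph c).1 hx
  rw [← c.toSubgraph_rotate hx']
  have hc' := SimpleGraph.Walk.IsCycle.rotate hx' hc
  generalize c.rotate x hx' = c' at hc'
  cases c' with
  | nil => exact absurd rfl hc'.ne_nil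
  | @cons _ y _ h p =>
    have hp := ((SimpleGraph.Walk.cons_isCycle_iff p h).1 hc').1
    refine preconnected_of_forall_exists_walk y fun w hw => ?_
    obtain ⟨hw, hwx⟩ := hw
    have hwx : w ≠ x := hwx
    have hwp : w ∈ p.support := by
      have := (SimpleGraph.Walk.mem_verts_toSubgraph _).1 hw
      rw [SimpleGraph.Walk.support_cons] at this
      exact (List.mem_cons.1 this).resolve_left hwx
    refine ⟨(p.takeUntil w hwp).reverse, ?_⟩
    rw [SimpleGraph.Walk.toSubgraph_reverse]
    refine le_deleteVerts ?_ ?_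
    · refine le_trans ?_ (b := p.toSubgraph) le_sup_right
      conv_rhs => rw [← p.take_spec hwp, SimpleGraph.Walk.toSubgraph_append]
      exact le_sup_left
    · rw [SimpleGraph.Walk.mem_verts_toSubgraph]
      exact SimpleGraph.Walk.endpoint_notMem_support_takeUntil hp hwp hwx.symm

/-- A nonseparable subgraph containing a bridge consists of that bridge alone. -/
lemma IsNonseparable.eq_of_isBridge {G : SimpleGraph V} {B : G.Subgraph} (hB : IsNonseparable B)
    {u v : V} (h : B.Adj u v) (hbr : G.IsBridge s(u, v)) :
    B = G.subgraphOfAdj (B.adj_sub h) := by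
  have hu := B.edge_vert h
  have hv := B.edge_vert h.symm
  have huv := (B.adj_sub h).ne
  have hverts : ∀ x ∈ B.verts, x = u ∨ x = v := by
    intro x hx
    by_contra! hcon
    obtain ⟨p, hp⟩ := hB.exists_walk_avoiding hu hx huv hcon.2
    obtain ⟨q, hq⟩ := hB.exists_walk_avoiding hx hv hcon.1 huv.symm
    have := SimpleGraph.isBridge_iff_forall_walk_mem_edges.1 hbr (p.append q)
    rw [SimpleGraph.Walk.edges_append, List.mem_append] at this
    rcases this with h | h
    · exact hp (p.snd_mem_support_of_mem_edges h)
    · exact hq (q.fst_mem_support_of_mem_edges h)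
  have hle : B ≤ G.subgraphOfAdj (B.adj_sub h) := by
    refine ⟨fun x hx => hverts x hx, fun x y hxy => ?_⟩
    have := (B.adj_sub hxy).ne
    rw [SimpleGraph.subgraphOfAdj_adj]
    rcases hverts x (B.edge_vert hxy) with rfl | rfl <;>
      rcases hverts y (B.edge_vert hxy.symm) with rfl | rfl
    · exact absurd rfl this
    · rfl
    · exact Sym2.eq_swap
    · exact absurd rfl this
  exact le_antisymm hle (SimpleGraph.subgraphOfAdj_le_of_adj B h)

/-! ### Ears -/

/-- An ear of a subgraph `K`: a path with distinct ends in `K` and with no other vertex and no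
edge in `K`. -/
structure IsEar {G : SimpleGraph V} (K : G.Subgraph) {u v : V} (p : G.Walk u v) : Prop where
  isPath : p.IsPath
  ne : u ≠ v
  mem_iff : ∀ x : V, (x ∈ K.verts ∧ x ∈ p.support) ↔ (x = u ∨ x = v)
  notMem_edgeSet : ∀ s ∈ p.edges, s ∉ K.edgeSet

/-- A subgraph `K` with at least two vertices that is properly contained in a nonseparable subgraph
has an ear. -/
lemma IsNonseparable.exists_isEar {G : SimpleGraph V} {K B : G.Subgraph} (hB : IsNonseparable B)
    (hKB : K ≤ B) (hne : K ≠ B) (hK : K.verts.Nontrivial) :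
    ∃ (u v : V) (p : G.Walk u v), IsEar K p := by
  classical
  by_cases hch : ∃ x y, x ∈ K.verts ∧ y ∈ K.verts ∧ B.Adj x y ∧ ¬ K.Adj x y
  · obtain ⟨x, y, hx, hy, hxy, hxy'⟩ := hch
    have hadj := B.adj_sub hxy
    refine ⟨x, y, hadj.toWalk, SimpleGraph.Walk.IsPath.of_adj hadj, hadj.ne, ?_, ?_⟩
    · intro z
      simp only [SimpleGraph.Adj.toWalk, SimpleGraph.Walk.support_cons,
        SimpleGraph.Walk.support_nil, List.mem_cons, List.not_mem_nil, or_false]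
      constructor
      · exact fun h => h.2
      · rintro (rfl | rfl)
        · exact ⟨hx, Or.inl rfl⟩
        · exact ⟨hy, Or.inr rfl⟩
    · intro s hs
      simp only [SimpleGraph.Adj.toWalk, SimpleGraph.Walk.edges_cons,
        SimpleGraph.Walk.edges_nil, List.mem_cons, List.not_mem_nil, or_false] at hs
      subst hs
      exact hxy'
  push Not at hch
  obtain ⟨w, hwB, hwK⟩ : ∃ w ∈ B.verts, w ∉ K.verts := by
    by_contra! hcon
    refine hne (le_antisymm hKB ⟨hcon, fun x y hxy => ?_⟩)
    exact hch x y (hcon x (B.edge_vert hxy)) (hcon y (B.edge_vert hxy.symm)) hxy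
  obtain ⟨k, hk⟩ := hK.nonempty
  obtain ⟨r, hr⟩ := (SimpleGraph.Subgraph.preconnected_iff_forall_exists_walk_subgraph _).1
    hB.1.preconnected (hKB.1 hk) hwB
  obtain ⟨d, hd, hd1, hd2⟩ := r.exists_boundary_dart K.verts hk hwK
  have hyx : B.Adj d.fst d.snd := hr.2 (SimpleGraph.Walk.adj_toSubgraph_iff_mem_edges.2
    (List.mem_map.2 ⟨d, hd, rfl⟩))
  generalize d.fst = y at hd1 hyx
  generalize d.snd = x at hd2 hyx
  obtain ⟨y', hy', hyy'⟩ := hK.exists_ne y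
  have hadj := B.adj_sub hyx
  -- leave `K` along `yx` and return to it without passing through `y`
  obtain ⟨q, hq⟩ := hB.exists_walk_avoiding (B.edge_vert hyx.symm) (hKB.1 hy') hadj.ne.symm hyy'
  have hqb : y ∉ q.bypass.support := fun h => hq (q.support_bypass_subset_support h)
  have hqp := q.bypass_isPath
  generalize q.bypass = q at hqb hqp
  obtain ⟨v, hv, hvq, hfirst⟩ := q.exists_mem_support_forall_mem_support_imp_eq
    (q.support.toFinset.filter (· ∈ K.verts))
    ⟨y', mem_filter.2 ⟨mem_filter.2 ⟨List.mem_toFinset.2 q.end_mem_support, hy'⟩,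
      q.end_mem_support⟩⟩
  have hvK := (mem_filter.1 hv).2
  have hpath := hqp.takeUntil hvq
  have hsub := q.support_takeUntil_subset_support hvq
  have hfirst' : ∀ t ∈ K.verts, t ∈ (q.takeUntil v hvq).support → t = v := fun t ht ht' =>
    hfirst t (mem_filter.2 ⟨List.mem_toFinset.2 (hsub ht'), ht⟩) ht'
  have hyt : y ∉ (q.takeUntil v hvq).support := fun h => hqb (hsub h)
  generalize q.takeUntil v hvq = q at hpath hfirst' hyt
  refine ⟨y, v, .cons hadj q, hpath.cons hyt, fun h => hyt (h ▸ q.end_mem_support), ?_, ?_⟩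
  · intro z
    rw [SimpleGraph.Walk.support_cons, List.mem_cons]
    constructor
    · rintro ⟨hz, rfl | h⟩
      · exact Or.inl rfl
      · exact Or.inr (hfirst' z hz h)
    · rintro (rfl | rfl)
      · exact ⟨hd1, Or.inl rfl⟩
      · exact ⟨hvK, Or.inr q.end_mem_support⟩
  · intro s hs hsK
    rw [SimpleGraph.Walk.edges_cons, List.mem_cons] at hs
    rcases hs with rfl | hs
    · exact hd2 (K.edge_vert (SimpleGraph.Subgraph.Adj.symm hsK))
    · induction s with | h a b =>
      have ha := hfirst' a (K.edge_vert hsK) (q.fst_mem_support_of_mem_edges hs)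
      have hb := hfirst' b (K.edge_vert (SimpleGraph.Subgraph.Adj.symm hsK))
        (q.snd_mem_support_of_mem_edges hs)
      subst ha
      subst hb
      exact (q.adj_of_mem_edges hs).ne rfl

/-! ### Complete bipartite subgraphs and cycles -/

lemma ncard_edgeSet_coe {G : SimpleGraph V} (H : G.Subgraph) :
    H.coe.edgeSet.ncard = H.edgeSet.ncard := by
  rw [← H.image_coe_edgeSet_coe]
  exact (Set.ncard_image_of_injective _ (Sym2.map.injective Subtype.val_injective)).symm

lemma ncard_edgeSet_of_iso {W W' : Type*} {G : SimpleGraph W} {G' : SimpleGraph W'}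
    (e : G ≃g G') : G.edgeSet.ncard = G'.edgeSet.ncard := by
  rw [← Nat.card_coe_set_eq, ← Nat.card_coe_set_eq]
  exact Nat.card_congr e.mapEdgeSet

lemma ncard_verts_of_iso {G : SimpleGraph V} {H : G.Subgraph} {n : ℕ} {W : Type*}
    {G' : SimpleGraph W} (e : H.coe ≃g G') (hn : Nat.card W = n) : H.verts.ncard = n := by
  rw [← Nat.card_coe_set_eq, ← hn]
  exact Nat.card_congr e.toEquiv

lemma ncard_edgeSet_completeBipartiteGraph (m : ℕ) :
    (completeBipartiteGraph (Fin 2) (Fin m)).edgeSet.ncard = 2 * m := by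
  rw [Set.ncard, SimpleGraph.encard_edgeSet_completeBipartiteGraph]
  simp

lemma exists_common_neighbors_of_isK2m {G : SimpleGraph V} {K : G.Subgraph} (h : IsK2m K.coe) :
    ∃ m : ℕ, 1 ≤ m ∧ K.verts.ncard = m + 2 ∧ K.edgeSet.ncard = 2 * m ∧
      ∃ p q : V, p ≠ q ∧ ∃ Z : Finset V, (∀ z ∈ Z, G.Adj p z ∧ G.Adj q z) ∧ Z.card = m := by
  classical
  obtain ⟨m, hm, ⟨e⟩⟩ := h
  refine ⟨m, hm, ncard_verts_of_iso e (by simp [add_comm]), ?_, (e.symm (.inl 0)).1,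
    (e.symm (.inl 1)).1, ?_, univ.image fun i => (e.symm (.inr i)).1, ?_, ?_⟩
  · rw [← ncard_edgeSet_coe, ncard_edgeSet_of_iso e, ncard_edgeSet_completeBipartiteGraph]
  · intro h
    simpa using e.symm.injective (Subtype.ext h)
  · intro z hz
    obtain ⟨i, -, rfl⟩ := mem_image.1 hz
    constructor
    · exact K.adj_sub (e.symm.map_adj_iff.2 (by simp) : K.coe.Adj (e.symm (.inl 0)) _)
    · exact K.adj_sub (e.symm.map_adj_iff.2 (by simp) : K.coe.Adj (e.symm (.inl 1)) _)
  · rw [card_image_of_injective, card_univ, Fintype.card_fin]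
    intro i j hij
    simpa using e.symm.injective (Subtype.ext hij)

/-- Two vertices `p`, `q` and a set `Z` of common neighbours span a complete bipartite graph. -/
lemma exists_subgraph_of_common_neighbors {G : SimpleGraph V} {p q : V} (hpq : p ≠ q)
    {Z : Finset V} (hZ : ∀ z ∈ Z, G.Adj p z ∧ G.Adj q z) :
    ∃ K : G.Subgraph, Nonempty (K.coe ≃g completeBipartiteGraph (Fin 2) (Fin Z.card)) ∧
      (∀ x, x ∈ K.verts ↔ x = p ∨ x = q ∨ x ∈ Z) ∧
      ∀ x y, K.Adj x y ↔ ((x = p ∨ x = q) ∧ y ∈ Z) ∨ (x ∈ Z ∧ (y = p ∨ y = q)) := by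
  classical
  let e := Z.equivFin.symm
  have hpZ : p ∉ Z := fun h => (hZ p h).1.ne rfl
  have hqZ : q ∉ Z := fun h => (hZ q h).2.ne rfl
  have hadj : ∀ (i : Fin 2) (j : Fin Z.card), G.Adj (![p, q] i) (e j) := by
    intro i j
    fin_cases i
    · exact (hZ _ (e j).2).1
    · exact (hZ _ (e j).2).2
  have hinj : Function.Injective ![p, q] := by
    intro i j hij
    fin_cases i <;> fin_cases j <;> simp_all
  have hval : ∀ y ∈ Z, ∃ j, (e j : V) = y := fun y hy => ⟨e.symm ⟨y, hy⟩, by simp⟩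
  have hpq' : ∀ x, (x = p ∨ x = q) ↔ ∃ i, ![p, q] i = x := by
    intro x; simp [Fin.exists_fin_two, eq_comm]
  let f : SimpleGraph.Copy (completeBipartiteGraph (Fin 2) (Fin Z.card)) G :=
    ⟨⟨Sum.elim ![p, q] fun j => e j, by
      rintro (i | i) (j | j) h
      · simp at h
      · exact hadj i j
      · exact (hadj j i).symm
      · simp at h⟩, by
      rintro (i | i) (j | j) h
      · exact congrArg _ (hinj h)
      · exact absurd h (hadj i j).ne
      · exact absurd h (hadj j i).ne.symm
      · exact congrArg _ (e.injective (Subtype.ext h))⟩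
  have hfl : ∀ i, f (.inl i) = ![p, q] i := fun _ => rfl
  have hfr : ∀ j, f (.inr j) = e j := fun _ => rfl
  refine ⟨f.toSubgraph, ⟨f.isoToSubgraph.symm⟩, fun x => ?_, fun x y => ?_⟩
  · simp only [SimpleGraph.Subgraph.map_verts, SimpleGraph.Subgraph.verts_top, Set.image_univ,
      Set.mem_range, SimpleGraph.Copy.toHom_apply]
    rw [← or_assoc, hpq']
    constructor
    · rintro ⟨i | j, rfl⟩
      · exact Or.inl ⟨i, rfl⟩
      · exact Or.inr (e j).2
    · rintro (⟨i, rfl⟩ | h)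
      · exact ⟨.inl i, rfl⟩
      · obtain ⟨j, rfl⟩ := hval x h
        exact ⟨.inr j, rfl⟩
  · simp only [SimpleGraph.Subgraph.map_adj, Relation.Map, SimpleGraph.Subgraph.top_adj,
      SimpleGraph.Copy.toHom_apply, hpq']
    constructor
    · rintro ⟨i | i, j | j, h, rfl, rfl⟩
      · simp at h
      · exact Or.inl ⟨⟨i, rfl⟩, (e j).2⟩
      · exact Or.inr ⟨(e i).2, ⟨j, rfl⟩⟩
      · simp at h
    · rintro (⟨⟨i, rfl⟩, hy⟩ | ⟨hx, ⟨i, rfl⟩⟩)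
      · obtain ⟨j, rfl⟩ := hval y hy
        exact ⟨.inl i, .inr j, by simp, rfl, rfl⟩
      · obtain ⟨j, rfl⟩ := hval x hx
        exact ⟨.inr j, .inl i, by simp, rfl, rfl⟩

lemma toSubgraph_toWalk_le {G : SimpleGraph V} {H : G.Subgraph} {x y : V} (h : H.Adj x y) :
    (H.adj_sub h).toWalk.toSubgraph ≤ H := by
  rw [SimpleGraph.Adj.toSubgraph_toWalk]
  exact SimpleGraph.subgraphOfAdj_le_of_adj H h

/-- The subgraph `K_{2,m}` with `m ≥ 2` is nonseparable. -/
lemma isNonseparable_of_common_neighbors {G : SimpleGraph V} {p q : V} (hpq : p ≠ q)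
    {Z : Finset V} (hZ2 : 2 ≤ Z.card) {K : G.Subgraph}
    (hverts : ∀ x, x ∈ K.verts ↔ x = p ∨ x = q ∨ x ∈ Z)
    (hadj : ∀ x y, K.Adj x y ↔ ((x = p ∨ x = q) ∧ y ∈ Z) ∨ (x ∈ Z ∧ (y = p ∨ y = q))) :
    IsNonseparable K := by
  have key : ∀ s : V, ∃ w, ∀ u ∈ (K.deleteVerts {s}).verts,
      ∃ r : G.Walk u w, r.toSubgraph ≤ K.deleteVerts {s} := by
    intro s
    -- with `z` a common neighbour other than `s`, every vertex is adjacent to `z`, `p` or `q`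
    obtain ⟨z, hz, hzs⟩ := exists_mem_ne hZ2 s
    obtain ⟨t, ht, hts⟩ : ∃ t, (t = p ∨ t = q) ∧ t ≠ s := by
      by_cases h : p = s
      · exact ⟨q, Or.inr rfl, fun h' => hpq (h.trans h'.symm)⟩
      · exact ⟨p, Or.inl rfl, h⟩
    have hedge : ∀ x y, x ≠ s → y ≠ s → (x = p ∨ x = q) → y ∈ Z →
        (K.deleteVerts {s}).Adj x y := by
      intro x y hxs hys hx hy
      have : K.Adj x y := (hadj x y).2 (Or.inl ⟨hx, hy⟩)
      exact SimpleGraph.Subgraph.deleteVerts_adj.2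
        ⟨K.edge_vert this, hxs, K.edge_vert this.symm, hys, this⟩
    refine ⟨z, fun u hu => ?_⟩
    obtain ⟨hu, hus⟩ := hu
    have hus : u ≠ s := hus
    have hcase : (u = p ∨ u = q) ∨ u ∈ Z := by rw [or_assoc]; exact (hverts u).1 hu
    rcases hcase with hu | hu
    · exact ⟨_, toSubgraph_toWalk_le (hedge u z hus hzs hu hz)⟩
    · refine ⟨((K.deleteVerts {s}).adj_sub (hedge t u hts hus ht hu).symm).toWalk.append
        ((K.deleteVerts {s}).adj_sub (hedge t z hts hzs ht hz)).toWalk, ?_⟩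
      rw [SimpleGraph.Walk.toSubgraph_append]
      exact sup_le (toSubgraph_toWalk_le (hedge t u hts hus ht hu).symm)
        (toSubgraph_toWalk_le (hedge t z hts hzs ht hz))
  refine ⟨SimpleGraph.Subgraph.connected_iff.2 ⟨?_, p, (hverts p).2 (Or.inl rfl)⟩,
    fun s _ => ?_⟩
  · obtain ⟨z, hz, -⟩ := exists_mem_ne hZ2 p
    have hadj' : ∀ x, (x = p ∨ x = q) → ∀ y ∈ Z, K.Adj x y :=
      fun x hx y hy => (hadj x y).2 (Or.inl ⟨hx, hy⟩)
    refine preconnected_of_forall_exists_walk z fun u hu => ?_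
    have hcase : (u = p ∨ u = q) ∨ u ∈ Z := by rw [or_assoc]; exact (hverts u).1 hu
    rcases hcase with hu | hu
    · exact ⟨_, toSubgraph_toWalk_le (hadj' u hu z hz)⟩
    · refine ⟨(K.adj_sub (hadj' p (Or.inl rfl) u hu).symm).toWalk.append
        (K.adj_sub (hadj' p (Or.inl rfl) z hz)).toWalk, ?_⟩
      rw [SimpleGraph.Walk.toSubgraph_append]
      exact sup_le (toSubgraph_toWalk_le (hadj' p (Or.inl rfl) u hu).symm)
        (toSubgraph_toWalk_le (hadj' p (Or.inl rfl) z hz))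
  · obtain ⟨w, hw⟩ := key s
    exact preconnected_of_forall_exists_walk w hw

lemma ncard_setOf_mem_of_nodup {α : Type*} {l : List α} (h : l.Nodup) :
    {x | x ∈ l}.ncard = l.length := by
  classical
  rw [← List.toFinset_card_of_nodup h, ← Set.ncard_coe_finset]
  congr 1; ext; simp

lemma ncard_edgeSet_toSubgraph {G : SimpleGraph V} {u v : V} {p : G.Walk u v} (hp : p.IsTrail) :
    p.toSubgraph.edgeSet.ncard = p.length := by
  rw [← p.length_edges, ← ncard_setOf_mem_of_nodup hp.edges_nodup]
  congr 1; ext e; exact p.mem_edges_toSubgraph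

lemma ncard_verts_toSubgraph_of_isPath {G : SimpleGraph V} {u v : V} {p : G.Walk u v}
    (hp : p.IsPath) : p.toSubgraph.verts.ncard = p.length + 1 := by
  rw [← p.length_support, ← ncard_setOf_mem_of_nodup hp.support_nodup, p.verts_toSubgraph]

lemma ncard_verts_toSubgraph_of_isCycle {G : SimpleGraph V} {v : V} {c : G.Walk v v}
    (hc : c.IsCycle) : c.toSubgraph.verts.ncard = c.length := by
  have h1 : c.support.tail.length = c.length := by simp
  rw [← h1, ← ncard_setOf_mem_of_nodup hc.support_nodup]
  congr 1; ext w
  rw [SimpleGraph.Walk.mem_verts_toSubgraph, Set.mem_ofPred_eq]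
  refine ⟨fun h => ?_, List.mem_of_mem_tail⟩
  rcases (SimpleGraph.Walk.mem_support_iff _).1 h with rfl | h
  · exact SimpleGraph.Walk.end_mem_tail_support hc.not_nil
  · exact h

lemma ncard_edgeSet_cycleGraph {n : ℕ} (hn : 3 ≤ n) :
    (SimpleGraph.cycleGraph n).edgeSet.ncard = n := by
  obtain ⟨n, rfl⟩ := Nat.exists_eq_add_of_le' hn
  have h := (SimpleGraph.cycleGraph (n + 3)).sum_degrees_eq_twice_card_edges
  simp only [SimpleGraph.cycleGraph_degree_three_le, sum_const, card_univ, Fintype.card_fin,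
    smul_eq_mul] at h
  rw [← SimpleGraph.coe_edgeFinset, Set.ncard_coe_finset]
  omega

lemma nonempty_iso_of_copy {W W' : Type*} [Finite W] [Finite W'] {G : SimpleGraph W}
    {G' : SimpleGraph W'} (f : SimpleGraph.Copy G G') (hv : Nat.card W' ≤ Nat.card W)
    (he : G'.edgeSet.ncard ≤ G.edgeSet.ncard) : Nonempty (G' ≃g G) := by
  have hbij : Function.Bijective f :=
    (Function.Injective.bijective_of_nat_card_le f.injective hv)
  have hsurj : Function.Surjective f.mapEdgeSet :=
    (Function.Injective.bijective_of_nat_card_le f.mapEdgeSet.injective he).2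
  refine ⟨SimpleGraph.Iso.symm ⟨Equiv.ofBijective f hbij, fun {a b} => ⟨fun h => ?_, fun h =>
    f.toHom.map_adj h⟩⟩⟩
  obtain ⟨⟨e, he⟩, hee⟩ := hsurj ⟨s(f a, f b), h⟩
  have hmap : Sym2.map f e = Sym2.map f s(a, b) := congrArg Subtype.val hee
  have := Sym2.map.injective f.injective hmap
  subst this
  exact he

lemma nonempty_iso_cycleGraph [Finite V] {G : SimpleGraph V} {v : V} {c : G.Walk v v}
    (hc : c.IsCycle) : Nonempty (c.toSubgraph.coe ≃g SimpleGraph.cycleGraph c.length) := by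
  have hc' : c.mapToSubgraph.IsCycle := by
    have h : (c.mapToSubgraph.map c.toSubgraph.hom).IsCycle := by
      rw [c.map_mapToSubgraph_hom]; exact hc
    exact h.of_map
  have hlen : c.mapToSubgraph.length = c.length :=
    (SimpleGraph.Walk.length_map c.toSubgraph.hom c.mapToSubgraph).symm.trans
      (congrArg SimpleGraph.Walk.length c.map_mapToSubgraph_hom)
  obtain ⟨f⟩ := (SimpleGraph.cycleGraph_isContained_iff hc.three_le_length).2
    ⟨_, c.mapToSubgraph, hc', hlen⟩
  refine nonempty_iso_of_copy f ?_ ?_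
  · rw [Nat.card_coe_set_eq, ncard_verts_toSubgraph_of_isCycle hc]; simp
  · rw [ncard_edgeSet_coe, ncard_edgeSet_toSubgraph hc.isTrail,
      ncard_edgeSet_cycleGraph hc.three_le_length]

lemma isOddCycle_toSubgraph [Finite V] {G : SimpleGraph V} {v : V} {c : G.Walk v v}
    (hc : c.IsCycle) (hodd : Odd c.length) : IsOddCycle c.toSubgraph.coe :=
  ⟨c.length, hc.three_le_length, hodd, nonempty_iso_cycleGraph hc⟩

lemma HasOddCycle.not_colorable {G : SimpleGraph V} (h : HasOddCycle G) : ¬ G.Colorable 2 := by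
  obtain ⟨v, p, -, hp⟩ := h
  intro hcol
  exact Nat.not_even_iff_odd.2 hp (SimpleGraph.two_colorable_iff_forall_loop_even.1 hcol v p)

/-! ### The structure of the graphs attaining equality -/

/-- In a `K₄`-free graph of cyclomatic number `g ≥ 2` that contains a `K_{2,g}`, every edge outside
of the `K_{2,g}` and of an odd cycle `c` is a bridge: otherwise its deletion would leave
too many `4`-cycles for the cyclomatic number `g - 1`. -/
lemma isBridge_of_notMem [Fintype V] {G : SimpleGraph V} (hG : G.Connected)
    (hk : G.CliqueFree 4) {g : ℕ} (hg : G.edgeSet.ncard + 1 = g + 2 + Fintype.card V) {p q : V}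
    (hpq : p ≠ q) {Z : Finset V} (hZ : ∀ z ∈ Z, G.Adj p z ∧ G.Adj q z) (hZc : Z.card = g + 2)
    {v : V} {c : G.Walk v v} (hc : c.IsCycle) (hodd : Odd c.length) {x y : V} (hxy : G.Adj x y)
    (hxyc : s(x, y) ∉ c.edges) (hxyZ : ∀ z ∈ Z, s(p, z) ≠ s(x, y) ∧ s(q, z) ≠ s(x, y)) :
    G.IsBridge s(x, y) := by
  classical
  by_contra hbr
  have hG' := hG.connected_delete_edge_of_not_isBridge hbr
  have hle := SimpleGraph.deleteEdges_le (G := G) {s(x, y)}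
  have hc' : ∀ e ∈ c.edges, e ∈ (G.deleteEdges {s(x, y)}).edgeSet := by
    intro e he
    rw [SimpleGraph.edgeSet_deleteEdges]
    exact ⟨c.edges_subset_edgeSet he, fun h => hxyc (h ▸ he)⟩
  have hcol : ¬ (G.deleteEdges {s(x, y)}).Colorable 2 :=
    HasOddCycle.not_colorable ⟨v, c.transfer _ hc', hc.transfer hc', by simpa using hodd⟩
  have h1 := ncard_edgeSet_deleteEdges (G := G) (e := s(x, y)) hxy
  have h2 := card_fourCycles_le (g := g + 1) hG' hcol
    (cliqueSet_subsingleton_of_cliqueFree (hk.anti hle)) (by omega)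
  have h3 := choose_two_le_card_fourCycles (G := G.deleteEdges {s(x, y)}) hpq (Z := Z)
    fun z hz => ⟨SimpleGraph.deleteEdges_adj.2 ⟨(hZ z hz).1, (hxyZ z hz).1⟩,
      SimpleGraph.deleteEdges_adj.2 ⟨(hZ z hz).2, (hxyZ z hz).2⟩⟩
  rw [hZc, choose_two_succ] at h3
  omega

/-- An ear raises the cyclomatic number `m - 1` of `K_{2,m}` to that of `G`, so without
leaves there is nothing else in `G`. -/
lemma isK2mWithPath_of_isEar [Fintype V] {G : SimpleGraph V} [DecidableRel G.Adj]
    (hG : G.Connected) (hdeg : ∀ v, G.degree v ≠ 1) {m : ℕ} (hm : 1 ≤ m)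
    (hg : G.edgeSet.ncard + 1 = m + Fintype.card V) {K : G.Subgraph}
    (e : K.coe ≃g completeBipartiteGraph (Fin 2) (Fin m)) {u v : V} {p : G.Walk u v}
    (hp : IsEar K p) : IsK2mWithPath G := by
  refine ⟨K, u, v, p, ⟨m, hm, ⟨e⟩⟩, hp.isPath, hp.ne, hp.mem_iff, hp.notMem_edgeSet, ?_⟩
  have hKv : K.verts.ncard = m + 2 := ncard_verts_of_iso e (by simp [add_comm])
  have hKe : K.edgeSet.ncard = 2 * m := by
    rw [← ncard_edgeSet_coe, ncard_edgeSet_of_iso e, ncard_edgeSet_completeBipartiteGraph]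
  have hpv := ncard_verts_toSubgraph_of_isPath hp.isPath
  have hpe := ncard_edgeSet_toSubgraph hp.isPath.isTrail
  have hv := Set.ncard_union_add_ncard_inter K.verts p.toSubgraph.verts
  have hinter : K.verts ∩ p.toSubgraph.verts = {u, v} := by
    ext x
    rw [Set.mem_inter_iff, SimpleGraph.Walk.mem_verts_toSubgraph, hp.mem_iff]; rfl
  rw [hinter, Set.ncard_pair hp.ne] at hv
  have he := Set.ncard_union_eq (s := K.edgeSet) (t := p.toSubgraph.edgeSet)
    (Set.disjoint_left.2 fun s hs hs' => hp.notMem_edgeSet s (p.mem_edges_toSubgraph.1 hs') hs)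
  refine eq_top_of_ncard_le hG hdeg ⟨u, Or.inl ((hp.mem_iff u).2 (Or.inl rfl)).1⟩ ?_
  rw [SimpleGraph.Subgraph.verts_sup, SimpleGraph.Subgraph.edgeSet_sup]
  omega

lemma IsBlock.exists_adj {G : SimpleGraph V} [Nontrivial V] (hG : G.Connected) {B : G.Subgraph}
    (hB : IsBlock G B) : ∃ x y, B.Adj x y := by
  by_contra! hcon
  obtain ⟨w, hw⟩ := hB.prop.1.nonempty
  obtain ⟨w', hw'⟩ := hG.preconnected.exists_adj_of_nontrivial w
  have hverts : ∀ x ∈ B.verts, x = w := by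
    intro x hx
    obtain ⟨r, hr⟩ := (SimpleGraph.Subgraph.preconnected_iff_forall_exists_walk_subgraph _).1
      hB.prop.1.preconnected hw hx
    cases r with
    | nil => rfl
    | @cons _ y _ h r => exact absurd (hr.2 (Or.inl rfl)) (hcon w y)
  have hle : B ≤ G.subgraphOfAdj hw' :=
    ⟨fun x hx => Or.inl (hverts x hx), fun x y hxy => absurd hxy (hcon x y)⟩
  exact hcon w w' ((hB.le_of_ge (isNonseparable_subgraphOfAdj hw') hle).2 rfl)

lemma IsBlock.eq_of_two_common {G : SimpleGraph V} {A B : G.Subgraph} (hA : IsBlock G A)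
    (hB : IsBlock G B) {x y : V} (hxy : x ≠ y) (hxA : x ∈ A.verts) (hxB : x ∈ B.verts)
    (hyA : y ∈ A.verts) (hyB : y ∈ B.verts) : A = B :=
  le_antisymm (hB.le_of_two_common hA.prop hxy hxA hxB hyA hyB)
    (hA.le_of_two_common hB.prop hxy hxB hxA hyB hyA)

lemma IsBridgeSubgraph.not_toSubgraph_le {G : SimpleGraph V} {B : G.Subgraph}
    (hB : IsBridgeSubgraph G B) {v : V} {c : G.Walk v v} (hc : c.IsCycle) :
    ¬ c.toSubgraph ≤ B := by
  obtain ⟨x, y, h, hbr, rfl⟩ := hB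
  intro hle
  have hadj := hle.2 (c.toSubgraph_adj_snd hc.not_nil)
  rw [SimpleGraph.subgraphOfAdj_adj] at hadj
  refine hbr.notMem_edges_of_isCycle hc ?_
  rw [hadj]
  exact SimpleGraph.Walk.adj_toSubgraph_iff_mem_edges.1 (c.toSubgraph_adj_snd hc.not_nil)

/-- If `K` is a block not containing the cycle `c`, and all edges outside of `K` and of `c` are
bridges, then the blocks are `K`, `c` and bridges. -/
lemma isBlock_cases [Fintype V] {G : SimpleGraph V} (hG : G.Connected) {K : G.Subgraph}
    (hK : IsBlock G K) {v : V} {c : G.Walk v v} (hc : c.IsCycle) (hcK : ¬ c.toSubgraph ≤ K)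
    (hbr : ∀ x y, G.Adj x y → s(x, y) ∉ c.edges → ¬ K.Adj x y → G.IsBridge s(x, y)) :
    IsBlock G c.toSubgraph ∧
      ∀ B, IsBlock G B → B ≠ K → B ≠ c.toSubgraph → IsBridgeSubgraph G B := by
  have hnt : Nontrivial V := ⟨v, _, (c.adj_snd hc.not_nil).ne⟩
  have key : ∀ B, IsBlock G B → B = K ∨ B = c.toSubgraph ∨ IsBridgeSubgraph G B := by
    intro B hB
    by_cases h1 : ∃ x y, B.Adj x y ∧ G.IsBridge s(x, y)
    · obtain ⟨x, y, hxy, hb⟩ := h1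
      exact Or.inr (Or.inr ⟨x, y, B.adj_sub hxy, hb, IsNonseparable.eq_of_isBridge hB.prop hxy hb⟩)
    by_cases h2 : ∃ x y, B.Adj x y ∧ K.Adj x y
    · obtain ⟨x, y, hxy, hxy'⟩ := h2
      exact Or.inl (hB.eq_of_two_common hK (B.adj_sub hxy).ne (B.edge_vert hxy)
        (K.edge_vert hxy') (B.edge_vert hxy.symm) (K.edge_vert hxy'.symm))
    push Not at h1 h2
    have h3 : ∀ x y, B.Adj x y → c.toSubgraph.Adj x y := by
      intro x y hxy
      by_contra hcon
      exact h1 x y hxy (hbr x y (B.adj_sub hxy)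
        (fun h => hcon (SimpleGraph.Walk.adj_toSubgraph_iff_mem_edges.2 h)) (h2 x y hxy))
    obtain ⟨x, y, hxy⟩ := hB.exists_adj hG
    have hcB : c.toSubgraph ≤ B := hB.le_of_two_common (isNonseparable_toSubgraph_of_isCycle hc)
      (B.adj_sub hxy).ne (c.toSubgraph.edge_vert (h3 x y hxy)) (B.edge_vert hxy)
      (c.toSubgraph.edge_vert (h3 x y hxy).symm) (B.edge_vert hxy.symm)
    have hBc : B ≤ c.toSubgraph := by
      refine ⟨fun w hw => ?_, fun x y => h3 x y⟩
      by_contra hwc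
      obtain ⟨r, hr⟩ := (SimpleGraph.Subgraph.preconnected_iff_forall_exists_walk_subgraph _).1
        hB.prop.1.preconnected (hcB.1 c.start_mem_verts_toSubgraph) hw
      obtain ⟨d, hd, -, hd2⟩ := r.exists_boundary_dart c.toSubgraph.verts
        c.start_mem_verts_toSubgraph hwc
      have hBd : B.Adj d.fst d.snd := hr.2 (SimpleGraph.Walk.adj_toSubgraph_iff_mem_edges.2
        (List.mem_map.2 ⟨d, hd, rfl⟩))
      exact hd2 (c.toSubgraph.edge_vert (h3 _ _ hBd).symm)
    exact Or.inr (Or.inl (le_antisymm hBc hcB))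
  refine ⟨?_, fun B hB hBK hBc => ((key B hB).resolve_left hBK).resolve_left hBc⟩
  obtain ⟨B, hcB, hB⟩ := exists_isBlock_ge (isNonseparable_toSubgraph_of_isCycle hc)
  rcases key B hB with rfl | rfl | h
  · exact absurd hcB hcK
  · exact hB
  · exact absurd hcB (h.not_toSubgraph_le hc)

lemma IsExtremal.structure_cases [Fintype V] [DecidableEq V] {G : SimpleGraph V}
    [DecidableRel G.Adj] {g : ℕ} (h : IsExtremal G g) (hdeg : ∀ v, G.degree v ≠ 1)
    (hodd : HasOddCycle G) :
    IsOddCycle G ∨ IsK2mWithPath G ∨ BlocksK2mOddCycleBridges G := by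
  obtain ⟨v, c, hc, hlen⟩ := hodd
  have hcyc := h.cyclomatic
  obtain _ | _ | g := g
  · have := card_le_ncard_edgeSet h.connected h.not_colorable
    omega
  · left
    have htop : c.toSubgraph = ⊤ := by
      refine eq_top_of_ncard_le h.connected hdeg ⟨v, c.start_mem_verts_toSubgraph⟩ ?_
      rw [ncard_verts_toSubgraph_of_isCycle hc, ncard_edgeSet_toSubgraph hc.isTrail]
      omega
    obtain ⟨n, hn, hno, ⟨e⟩⟩ := isOddCycle_toSubgraph hc hlen
    rw [htop] at e
    exact ⟨n, hn, hno, ⟨SimpleGraph.Subgraph.topIso.symm.trans e⟩⟩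
  right
  obtain ⟨p, q, hpq, Z, hZ, hZc⟩ := h.exists_common_neighbors
  obtain ⟨K, ⟨e⟩, hverts, hadj⟩ := exists_subgraph_of_common_neighbors hpq hZ
  rw [hZc] at e
  have hKns : IsNonseparable K :=
    isNonseparable_of_common_neighbors hpq (by omega) hverts hadj
  by_cases hKB : IsBlock G K
  · right
    have hcK : ¬ c.toSubgraph ≤ K := by
      intro hle
      have hcol : K.spanningCoe.Colorable 2 := by
        classical
        refine ⟨SimpleGraph.Coloring.mk (fun x => if x ∈ Z then 0 else 1) fun {x y} hxy => ?_⟩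
        have hpZ : p ∉ Z := fun h => (hZ p h).1.ne rfl
        have hqZ : q ∉ Z := fun h => (hZ q h).2.ne rfl
        rcases (hadj x y).1 hxy with ⟨rfl | rfl, hy⟩ | ⟨hx, rfl | rfl⟩ <;> simp [*]
      have hc' : ∀ e ∈ c.edges, e ∈ K.spanningCoe.edgeSet := by
        intro e he
        have := SimpleGraph.Subgraph.edgeSet_mono hle (c.mem_edges_toSubgraph.2 he)
        rwa [SimpleGraph.Subgraph.edgeSet_spanningCoe]
      have := SimpleGraph.two_colorable_iff_forall_loop_even.1 hcol v (c.transfer _ hc')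
      rw [SimpleGraph.Walk.length_transfer] at this
      exact Nat.not_even_iff_odd.2 hlen this
    obtain ⟨h1, h2⟩ := isBlock_cases h.connected hKB hc hcK fun x y hxy hxyc hxyK => by
      refine isBridge_of_notMem h.connected h.cliqueFree hcyc hpq hZ hZc hc hlen hxy hxyc
        fun z hz => ⟨fun he => hxyK ?_, fun he => hxyK ?_⟩
      · rw [← SimpleGraph.Subgraph.mem_edgeSet, ← he]
        exact (hadj p z).2 (Or.inl ⟨Or.inl rfl, hz⟩)
      · rw [← SimpleGraph.Subgraph.mem_edgeSet, ← he]
        exact (hadj q z).2 (Or.inl ⟨Or.inr rfl, hz⟩)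
    exact ⟨K, c.toSubgraph, hKB, h1, ⟨g + 2, by omega, ⟨e⟩⟩, isOddCycle_toSubgraph hc hlen, h2⟩
  · left
    obtain ⟨B, hle, hB⟩ := exists_isBlock_ge hKns
    obtain ⟨u, v, r, hr⟩ := IsNonseparable.exists_isEar hB.prop hle (fun h => hKB (h ▸ hB))
      ⟨p, (hverts p).2 (Or.inl rfl), q, (hverts q).2 (Or.inr (Or.inl rfl)), hpq⟩
    exact isK2mWithPath_of_isEar h.connected hdeg (by omega) hcyc e hr

/-! ### The listed graphs attain equality -/

/-- A connected subgraph `H` has a set `D` of as many edges as its cyclomatic number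
that meets every cycle in `H`: the complement of a spanning tree. -/
lemma exists_edges_meeting_cycles [Fintype V] {G : SimpleGraph V} {H : G.Subgraph}
    (hH : H.Connected) :
    ∃ D : Set (Sym2 V), D.ncard + H.verts.ncard = H.edgeSet.ncard + 1 ∧
      ∀ (v : V) (c : G.Walk v v), c.IsCycle → c.toSubgraph ≤ H → ∃ e ∈ c.edges, e ∈ D := by
  classical
  obtain ⟨T, hTle, hT⟩ := hH.coe.exists_isTree_le
  have hsub : T.edgeSet ⊆ H.coe.edgeSet := SimpleGraph.edgeSet_mono hTle
  refine ⟨Sym2.map Subtype.val '' (H.coe.edgeSet \ T.edgeSet), ?_, ?_⟩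
  · rw [Set.ncard_image_of_injective _ (Sym2.map.injective Subtype.val_injective)]
    have h1 := Set.ncard_sdiff_add_ncard_of_subset hsub (Set.toFinite _)
    have h2 := (SimpleGraph.isTree_iff_connected_and_card.1 hT).2
    rw [Nat.card_coe_set_eq, Nat.card_coe_set_eq] at h2
    rw [ncard_edgeSet_coe] at h1
    omega
  · intro v c hc hle
    by_contra! hcon
    let c' := c.mapToSubgraph.map (SimpleGraph.Subgraph.inclusion hle)
    have hmap : c'.map H.hom = c := by
      rw [SimpleGraph.Walk.map_map]
      exact c.map_mapToSubgraph_hom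
    have hc' : c'.IsCycle := by
      have h : (c'.map H.hom).IsCycle := by rw [hmap]; exact hc
      exact h.of_map
    refine hT.isAcyclic (c'.transfer T fun e he => ?_) (hc'.transfer _)
    by_contra heT
    refine hcon (Sym2.map Subtype.val e) ?_ ⟨e, ⟨c'.edges_subset_edgeSet he, heT⟩, rfl⟩
    have : c.edges = c'.edges.map (Sym2.map H.hom) :=
      (congrArg SimpleGraph.Walk.edges hmap).symm.trans (SimpleGraph.Walk.edges_map _ _)
    rw [this]
    exact List.mem_map.2 ⟨e, he, rfl⟩

/-- If a set of edges meets every cycle, then it is at least as large as the cyclomatic number. -/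
lemma ncard_edgeSet_add_one_le [Fintype V] {G : SimpleGraph V} (hG : G.Connected)
    {D : Set (Sym2 V)} (hD : ∀ (v : V) (c : G.Walk v v), c.IsCycle → ∃ e ∈ c.edges, e ∈ D) :
    G.edgeSet.ncard + 1 ≤ D.ncard + Fintype.card V := by
  have hac : (G.deleteEdges D).IsAcyclic := by
    intro v c hc
    obtain ⟨e, he, heD⟩ := hD v _ (hc.mapLe (SimpleGraph.deleteEdges_le D))
    rw [SimpleGraph.Walk.edges_mapLe_eq_edges] at he
    have := c.edges_subset_edgeSet he
    rw [SimpleGraph.edgeSet_deleteEdges] at this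
    exact this.2 heD
  obtain ⟨T, hle, -, hT⟩ :=
    hG.exists_isTree_le_of_le_of_isAcyclic (SimpleGraph.deleteEdges_le D) hac
  have h1 := Set.ncard_le_ncard (SimpleGraph.edgeSet_mono hle) (Set.toFinite _)
  have h2 := (SimpleGraph.isTree_iff_connected_and_card.1 hT).2
  rw [Nat.card_coe_set_eq, Nat.card_eq_fintype_card] at h2
  rw [SimpleGraph.edgeSet_deleteEdges] at h1
  have h3 := Set.ncard_le_ncard_sdiff_add_ncard G.edgeSet D (Set.toFinite _)
  omega

lemma BlocksK2mOddCycleBridges.exists_common_neighbors [Fintype V] {G : SimpleGraph V}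
    (hG : G.Connected) (h : BlocksK2mOddCycleBridges G) :
    ∃ p q : V, p ≠ q ∧ ∃ Z : Finset V, (∀ z ∈ Z, G.Adj p z ∧ G.Adj q z) ∧
      G.edgeSet.ncard + 1 ≤ Z.card + Fintype.card V := by
  obtain ⟨B₁, B₂, h₁, h₂, hK, ⟨n, hn, -, ⟨e⟩⟩, hB⟩ := h
  obtain ⟨m, hm, hv, he, p, q, hpq, Z, hZ, hZc⟩ := exists_common_neighbors_of_isK2m hK
  refine ⟨p, q, hpq, Z, hZ, ?_⟩
  obtain ⟨D₁, hD₁, hcyc₁⟩ := exists_edges_meeting_cycles h₁.prop.1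
  obtain ⟨D₂, hD₂, hcyc₂⟩ := exists_edges_meeting_cycles h₂.prop.1
  have hv₂ : B₂.verts.ncard = n := ncard_verts_of_iso e (by simp)
  have he₂ : B₂.edgeSet.ncard = n := by
    rw [← ncard_edgeSet_coe, ncard_edgeSet_of_iso e, ncard_edgeSet_cycleGraph hn]
  have hle := ncard_edgeSet_add_one_le (D := D₁ ∪ D₂) hG fun v c hc => by
    obtain ⟨B, hcB, hBB⟩ := exists_isBlock_ge (isNonseparable_toSubgraph_of_isCycle hc)
    by_cases hB₁ : B = B₁
    · obtain ⟨s, hs, hsD⟩ := hcyc₁ v c hc (hB₁ ▸ hcB)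
      exact ⟨s, hs, Or.inl hsD⟩
    by_cases hB₂ : B = B₂
    · obtain ⟨s, hs, hsD⟩ := hcyc₂ v c hc (hB₂ ▸ hcB)
      exact ⟨s, hs, Or.inr hsD⟩
    exact absurd hcB ((hB B hBB hB₁ hB₂).not_toSubgraph_le hc)
  have := Set.ncard_union_le D₁ D₂
  omega

lemma IsK2mWithPath.exists_common_neighbors [Fintype V] {G : SimpleGraph V}
    (h : IsK2mWithPath G) :
    ∃ p q : V, p ≠ q ∧ ∃ Z : Finset V, (∀ z ∈ Z, G.Adj p z ∧ G.Adj q z) ∧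
      G.edgeSet.ncard + 1 ≤ Z.card + Fintype.card V := by
  obtain ⟨K, u, v, r, hK, hr, huv, hmem, -, htop⟩ := h
  obtain ⟨m, hm, hv, he, p, q, hpq, Z, hZ, hZc⟩ := exists_common_neighbors_of_isK2m hK
  refine ⟨p, q, hpq, Z, hZ, ?_⟩
  have h1 := congrArg (fun H : G.Subgraph => H.verts.ncard) htop
  have h2 := congrArg (fun H : G.Subgraph => H.edgeSet.ncard) htop
  simp only [SimpleGraph.Subgraph.verts_sup, SimpleGraph.Subgraph.edgeSet_sup,
    SimpleGraph.Subgraph.verts_top, SimpleGraph.Subgraph.edgeSet_top, Set.ncard_univ,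
    Nat.card_eq_fintype_card] at h1 h2
  have h3 := Set.ncard_union_add_ncard_inter K.verts r.toSubgraph.verts
  have hinter : K.verts ∩ r.toSubgraph.verts = {u, v} := by
    ext x
    rw [Set.mem_inter_iff, SimpleGraph.Walk.mem_verts_toSubgraph, hmem]; rfl
  rw [hinter, Set.ncard_pair huv, ncard_verts_toSubgraph_of_isPath hr] at h3
  have h4 := Set.ncard_union_le K.edgeSet r.toSubgraph.edgeSet
  rw [ncard_edgeSet_toSubgraph hr.isTrail] at h4
  omega

end FourCycles

/-- Here `d = Fintype.card V` and `e = G.edgeFinset.card`; since `G` is connected, `d ≤ e + 1`,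
so the subtraction in `e + 1 - d` is not truncated. -/
theorem theorem1p5 {V : Type*} [Fintype V] [DecidableEq V] (G : SimpleGraph V)
    [DecidableRel G.Adj] (hconn : G.Connected) (hodd : FourCycles.HasOddCycle G)
    (hk : FourCycles.k4 G ≤ 1) :
    FourCycles.c4 G ≤ (G.edgeFinset.card + 1 - Fintype.card V).choose 2 ∧
    ((∀ v : V, G.degree v ≠ 1) → FourCycles.k4 G = 0 →
      (FourCycles.c4 G = (G.edgeFinset.card + 1 - Fintype.card V).choose 2 ↔
        (FourCycles.IsOddCycle G ∨ FourCycles.IsK2mWithPath G ∨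
          FourCycles.BlocksK2mOddCycleBridges G))) := by
  have hcol := hodd.not_colorable
  have hE : G.edgeFinset.card = G.edgeSet.ncard := by
    rw [← SimpleGraph.coe_edgeFinset, Set.ncard_coe_finset]
  have hd := FourCycles.card_le_ncard_edgeSet hconn hcol
  rw [hE, FourCycles.c4_eq_card_fourCycles]
  obtain ⟨g, hg⟩ : ∃ g, G.edgeSet.ncard + 1 - Fintype.card V = g := ⟨_, rfl⟩
  rw [hg]
  replace hg : G.edgeSet.ncard + 1 = g + Fintype.card V := by omega
  have hle : (FourCycles.fourCycles G).card ≤ g.choose 2 :=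
    FourCycles.card_fourCycles_le hconn hcol
      (fun s hs t ht => FourCycles.isNClique_eq_of_k4_le_one hk hs ht) hg
  refine ⟨hle, fun hdeg hk0 => ⟨fun heq => ?_, fun h => le_antisymm hle ?_⟩⟩
  · exact FourCycles.IsExtremal.structure_cases
      ⟨hconn, hcol, FourCycles.cliqueFree_of_k4_eq_zero hk0, hg, heq⟩ hdeg hodd
  · -- it suffices to find a `K_{2,m}` with `m` at least the cyclomatic number
    have key : (∃ p q : V, p ≠ q ∧ ∃ Z : Finset V, (∀ z ∈ Z, G.Adj p z ∧ G.Adj q z) ∧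
        G.edgeSet.ncard + 1 ≤ Z.card + Fintype.card V) →
        g.choose 2 ≤ (FourCycles.fourCycles G).card := by
      rintro ⟨p, q, hpq, Z, hZ, hZc⟩
      exact (Nat.choose_le_choose 2 (by omega)).trans
        (FourCycles.choose_two_le_card_fourCycles hpq hZ)
    rcases h with ⟨n, hn, -, ⟨e⟩⟩ | h | h
    · have h1 := FourCycles.ncard_edgeSet_of_iso e
      have h2 := Nat.card_congr e.toEquiv
      rw [FourCycles.ncard_edgeSet_cycleGraph hn] at h1
      rw [Nat.card_eq_fintype_card, Nat.card_fin] at h2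
      obtain rfl : g = 1 := by omega
      simp
    · exact key h.exists_common_neighbors
    · exact key (h.exists_common_neighbors hconn)
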